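/- Let $a_1,a_2>0$, let $\Omega=\,]0,a_1[\,\times\,]0,a_2[$, and let $\omega\subseteq\Omega$ be a nonempty open subregion. Let $A$ be the Laplacian on $L^2(\Omega)$ with homogeneous Dirichlet conditions, i.e. $Av=g$ iff $v\in H^1_0(\Omega)$ and $\Delta v=g\in L^2(\Omega)$ weakly, and let $B:\mathbb R^m\to L^2(\Omega)$ be linear. Let $D=\,]\xi_{01}-l_1,\xi_{01}+l_1[\,\times\,]\xi_{02}-l_2,\xi_{02}+l_2[\,\subseteq\Omega$ with $l_1,l_2>0$, and let $f\in L^2(D)$ be symmetric about the lines $\xi_1=\xi_{01}$ and $\xi_2=\xi_{02}$. Consider the diffusion system observed by the zone sensor $(D,f)$, $$\dot x=Ax+Bu,\quad x(0)=x_0\in L^2(\Omega),\qquad y=Cx:=\int_D x\,f\,d\xi,$$ and, for $h\in L^2(\Omega)$ with the associated gain $H:\mathbb R\to L^2(\Omega)$, $Hy=y\,h$, the dynamical system $$\dot z=Az+Bu-H(Cz-y),\quad z(0)=z_0\in L^2(\Omega).\tag{19}$$ Solutions are mild solutions, $u\in L^2_{\rm loc}([0,\infty);\mathbb R^m)$.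 Write $\chi_\omega\nabla v=\nabla v|_\omega$, with values in $(H^1(\omega))^2$ (defined for those $v$ whose weak gradient on $\omega$ lies in that space). *Definitions.* A strongly continuous semigroup $(S(t))_{t\ge0}$ on $L^2(\Omega)$ with generator $F$ is *$\omega_G$-stable* if there are $M,\alpha>0$ with $\|\chi_\omega\nabla S(t)v\|_{(H^1(\omega))^2}\le Me^{-\alpha t}(\|v\|+\|Fv\|)$ for all $t\ge0$, $v\in D(F)$ (in particular $\chi_\omega\nabla S(t)v$ exists). A system $\dot z=Fz+Gu+Hy$ on $L^2(\Omega)$ is a *general asymptotic regional gradient observer* ($GA\omega_G$-observer) for $\dot x=Ax+Bu$, $y=Cx$, relative to a bounded operator $T$ on $L^2(\Omega)$, if: 1. $T$ maps $D(A)$ into $D(F)$, $TA-FT=HC$ on $D(A)$, and $G=TB$; 2. there are bounded linear $M:\mathbb R\to(H^1(\omega))^2$ and $N:(H^1(\omega))^2\to(H^1(\omega))^2$ with $MC+N\chi_\omega\nabla T=\chi_\omega\nabla$ on $D(A)$ (in particular both gradients exist there); 3. $A$ and $F$ generate strongly continuous semigroups and that of $F$ is $\omega_G$-stable; 4. for all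 $x_0,z_0\in L^2(\Omega)$ and all controls $u$, $\chi_\omega\nabla\big(z(t)-Tx(t)\big)$ exists in $(H^1(\omega))^2$ for every $t>0$ and tends to $0$ in $(H^1(\omega))^2$ as $t\to\infty$. **Corollary 5.1.** Let $J\ge 0$ be an integer and suppose $\frac{i\xi_{01}}{a_1}\notin\mathbb N$ and $\frac{j\xi_{02}}{a_2}\notin\mathbb N$ for all $i,j\in\{1,\dots,J\}$. Then there is a gain $H$ for which $A-HC$ generates a strongly continuous $\omega_G$-stable semigroup; and for every such gain, the dynamical system (19), i.e. the system with $F=A-HC$, $G=B$ and gain $H$, is a $GA\omega_G$-observer for the diffusion system, relative to $T=I$. -/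

import Mathlib

open MeasureTheory Set Filter Topology

noncomputable section

namespace GradientObserver

/-! ### Sobolev spaces on open subsets of the plane -/

/-- The real Hilbert space `L²(U)` for `U ⊆ ℝ²` with Lebesgue measure. -/
abbrev L2 (U : Set (ℝ × ℝ)) : Type := Lp ℝ 2 ((volume : Measure (ℝ × ℝ)).restrict U)

/-- The partial derivative `∂φ/∂ξₖ` of a differentiable function on the plane
(`k = 0` is the first coordinate, `k = 1` the second). -/
def partialDeriv (k : Fin 2) (φ : ℝ × ℝ → ℝ) (p : ℝ × ℝ) : ℝ :=
  fderiv ℝ φ p ((![(1, 0), (0, 1)] : Fin 2 → ℝ × ℝ) k)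

/-- Test functions on `U`: smooth functions whose support is compact and contained in `U`. -/
def IsTestFunction (U : Set (ℝ × ℝ)) (φ : ℝ × ℝ → ℝ) : Prop :=
  ContDiff ℝ ((⊤ : ℕ∞) : WithTop ℕ∞) φ ∧ HasCompactSupport φ ∧ tsupport φ ⊆ U

/-- `g` is the weak partial derivative `∂u/∂ξₖ` on `U`. -/
def HasWeakPartialDeriv (U : Set (ℝ × ℝ)) (k : Fin 2) (u g : ℝ × ℝ → ℝ) : Prop :=
  ∀ φ : ℝ × ℝ → ℝ, IsTestFunction U φ →
    ∫ p in U, u p * partialDeriv k φ p = - ∫ p in U, g p * φ p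

/-- `L²(U) × L²(U)²` with its Hilbert norm: a function together with a candidate gradient. -/
abbrev Jet (U : Set (ℝ × ℝ)) : Type := WithLp 2 (L2 U × PiLp 2 (fun _ : Fin 2 => L2 U))

theorem IsTestFunction.memLp {U : Set (ℝ × ℝ)} {φ : ℝ × ℝ → ℝ} (h : IsTestFunction U φ) :
    MemLp φ 2 (volume.restrict U) :=
  (h.1.continuous.memLp_of_hasCompactSupport h.2.1).restrict U

theorem IsTestFunction.memLp_partialDeriv {U : Set (ℝ × ℝ)} {φ : ℝ × ℝ → ℝ}
    (h : IsTestFunction U φ) (k : Fin 2) : MemLp (partialDeriv k φ) 2 (volume.restrict U) := by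
  have hc : Continuous (partialDeriv k φ) :=
    (h.1.continuous_fderiv (by simp)).clm_apply continuous_const
  have hs : HasCompactSupport (partialDeriv k φ) := h.2.1.fderiv_apply (𝕜 := ℝ) _
  exact (hc.memLp_of_hasCompactSupport hs).restrict U

theorem HasWeakPartialDeriv.zero (U : Set (ℝ × ℝ)) (k : Fin 2) :
    HasWeakPartialDeriv U k (0 : L2 U) (0 : L2 U) := by
  intro φ _
  have h0 := Lp.coeFn_zero ℝ 2 ((volume : Measure (ℝ × ℝ)).restrict U)
  have key : ∀ ψ : ℝ × ℝ → ℝ, ∫ p in U, (0 : L2 U) p * ψ p = 0 := fun ψ =>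
    integral_eq_zero_of_ae (h0.mono fun p hp => by
      change (0 : L2 U) p * ψ p = 0
      rw [hp, Pi.zero_apply, zero_mul])
  rw [key, key, neg_zero]

theorem HasWeakPartialDeriv.add {U : Set (ℝ × ℝ)} {k : Fin 2} {u g u' g' : L2 U}
    (h : HasWeakPartialDeriv U k u g) (h' : HasWeakPartialDeriv U k u' g') :
    HasWeakPartialDeriv U k (u + u' : L2 U) (g + g' : L2 U) := by
  intro φ hφ
  have key : ∀ (v v' : L2 U) (ψ : ℝ × ℝ → ℝ), MemLp ψ 2 (volume.restrict U) →
      ∫ p in U, (v + v' : L2 U) p * ψ p = (∫ p in U, v p * ψ p) + ∫ p in U, v' p * ψ p := by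
    intro v v' ψ hψ
    refine Eq.trans ?_
      (integral_add ((Lp.memLp v).integrable_mul hψ) ((Lp.memLp v').integrable_mul hψ))
    refine integral_congr_ae ((Lp.coeFn_add v v').mono fun p hp => ?_)
    simp only [hp, Pi.add_apply, add_mul]
  rw [key _ _ _ (hφ.memLp_partialDeriv k), key _ _ _ hφ.memLp, h φ hφ, h' φ hφ, neg_add]

theorem HasWeakPartialDeriv.smul {U : Set (ℝ × ℝ)} {k : Fin 2} {u g : L2 U} (c : ℝ)
    (h : HasWeakPartialDeriv U k u g) :
    HasWeakPartialDeriv U k (c • u : L2 U) (c • g : L2 U) := by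
  intro φ hφ
  have key : ∀ (v : L2 U) (ψ : ℝ × ℝ → ℝ),
      ∫ p in U, (c • v : L2 U) p * ψ p = c * ∫ p in U, v p * ψ p := by
    intro v ψ
    rw [← integral_const_mul]
    refine integral_congr_ae ((Lp.coeFn_smul c v).mono fun p hp => ?_)
    simp only [hp, Pi.smul_apply, smul_eq_mul, mul_assoc]
  rw [key, key, h φ hφ, mul_neg]

/-- The Sobolev space `H¹(U)`, realized as the space of pairs `(u, ∇u)` with `u ∈ L²(U)` and weak
gradient `∇u ∈ L²(U)²`; the norm inherited from `Jet U` is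
`‖u‖² = ‖u‖²_{L²} + ‖∂u/∂ξ₁‖²_{L²} + ‖∂u/∂ξ₂‖²_{L²}`. -/
def H1 (U : Set (ℝ × ℝ)) : Submodule ℝ (Jet U) where
  carrier := {w | ∀ k : Fin 2, HasWeakPartialDeriv U k w.fst (w.snd k)}
  zero_mem' := fun k => HasWeakPartialDeriv.zero U k
  add_mem' := fun ha hb k => (ha k).add (hb k)
  smul_mem' := fun c _ ha k => (ha k).smul c

/-- `H₀¹(U)`: the closure in the `H¹` norm of the test functions on `U`. -/
def H10 (U : Set (ℝ × ℝ)) : Set (Jet U) :=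
  closure {w | ∃ φ : ℝ × ℝ → ℝ, IsTestFunction U φ ∧
    (w.fst : ℝ × ℝ → ℝ) =ᵐ[volume.restrict U] φ ∧
    ∀ k : Fin 2, (w.snd k : ℝ × ℝ → ℝ) =ᵐ[volume.restrict U] partialDeriv k φ}

/-- The space `(H¹(ω))²` in which regional gradients live. -/
abbrev H1Sq (ω : Set (ℝ × ℝ)) : Type := PiLp 2 (fun _ : Fin 2 => H1 ω)

/-- `χ_ω ∇ v = P`: the restriction to `ω` of the gradient of `v ∈ L²(Ω)` is the element `P` of
`(H¹(ω))²`.  For `ω ⊆ Ω` open there is at most one such `P`. -/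
def IsRegionalGradient {Ω : Set (ℝ × ℝ)} (ω : Set (ℝ × ℝ)) (v : L2 Ω) (P : H1Sq ω) : Prop :=
  ∀ k : Fin 2, HasWeakPartialDeriv ω k v (P k : Jet ω).fst

/-! ### Unbounded operators and semigroups

An unbounded operator on `E` is given by its graph `A : E → E → Prop`: `A v g` says that `v`
belongs to the domain `D(A)` and `A v = g`. -/

/-- The Laplacian on `U` with homogeneous Dirichlet boundary condition, as an operator on `L²(U)`:
`v ∈ H₀¹(U)` and `Δv = g ∈ L²(U)` in the weak sense. -/
def DirichletLaplacian (U : Set (ℝ × ℝ)) (v g : L2 U) : Prop :=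
  ∃ w ∈ H10 U, w.fst = v ∧ ∀ φ : ℝ × ℝ → ℝ, IsTestFunction U φ →
    ∫ p in U, ∑ k : Fin 2, (w.snd k : ℝ × ℝ → ℝ) p * partialDeriv k φ p = - ∫ p in U, g p * φ p

/-- The operator `A - H C` with domain `D(A)`, for an output functional `C` and the operator
`H : ℝ → E`, `y ↦ y h`. -/
def outputInjection {E : Type*} [AddCommGroup E] [Module ℝ E]
    (A : E → E → Prop) (C : E → ℝ) (h : E) (v g : E) : Prop :=
  A v (g + C v • h)

/-- `(S t)_{t ≥ 0}` is a strongly continuous semigroup (values at `t < 0` are irrelevant). -/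
def IsC0Semigroup {E : Type*} [NormedAddCommGroup E] [NormedSpace ℝ E]
    (S : ℝ → E →L[ℝ] E) : Prop :=
  S 0 = ContinuousLinearMap.id ℝ E ∧
  (∀ s t : ℝ, 0 ≤ s → 0 ≤ t → S (s + t) = (S s).comp (S t)) ∧
  ∀ v : E, ContinuousOn (fun t => S t v) (Ici 0)

/-- `S` is a strongly continuous semigroup whose infinitesimal generator is exactly `A`. -/
def Generates {E : Type*} [NormedAddCommGroup E] [NormedSpace ℝ E]
    (A : E → E → Prop) (S : ℝ → E →L[ℝ] E) : Prop :=
  IsC0Semigroup S ∧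
  ∀ v g : E, A v g ↔ Tendsto (fun t : ℝ => t⁻¹ • (S t v - v)) (𝓝[>] 0) (𝓝 g)

/-- The mild solution at time `t`, `S(t) x₀ + ∫₀ᵗ S(t - τ) g(τ) dτ`, of `x' = A x + g`,
`x(0) = x₀`, where `S` is the semigroup generated by `A`. -/
def mildSolution {E : Type*} [NormedAddCommGroup E] [NormedSpace ℝ E]
    (S : ℝ → E →L[ℝ] E) (g : ℝ → E) (x₀ : E) (t : ℝ) : E :=
  S t x₀ + ∫ τ in (0 : ℝ)..t, S (t - τ) (g τ)

/-- The semigroup `S` on `L²(Ω)` with generator `F` is regionally gradient stable on `ω`: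
`‖χ_ω ∇ S(t)‖ ≤ M e^{-αt}` for all `t ≥ 0`, in the operator norm from `D(F)` with its graph norm
`‖v‖ + ‖F v‖` to `(H¹(ω))²`. -/
def IsRegionallyGradientStable {Ω : Set (ℝ × ℝ)} (ω : Set (ℝ × ℝ))
    (F : L2 Ω → L2 Ω → Prop) (S : ℝ → L2 Ω →L[ℝ] L2 Ω) : Prop :=
  ∃ M α : ℝ, 0 < M ∧ 0 < α ∧ ∀ v g : L2 Ω, F v g → ∀ t : ℝ, 0 ≤ t →
    ∃ P : H1Sq ω, IsRegionalGradient ω (S t v) P ∧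
      ‖P‖ ≤ M * Real.exp (-(α * t)) * (‖v‖ + ‖g‖)

/-! ### Outputs and observers -/

/-- The output of the zone sensor `(D, f)`: `C v = ∫_D v f`. -/
def zoneOutput {Ω : Set (ℝ × ℝ)} (D : Set (ℝ × ℝ)) (f : ℝ × ℝ → ℝ) (v : L2 Ω) : ℝ :=
  ∫ p in D, v p * f p

/-- The operator `H : ℝ → L²(Ω)`, `y ↦ y h`, is a gain for which `A - H C` generates a strongly
continuous semigroup that is regionally gradient stable on `ω`. -/
def IsStabilizingGain {Ω : Set (ℝ × ℝ)} (ω : Set (ℝ × ℝ)) (A : L2 Ω → L2 Ω → Prop)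
    (C : L2 Ω → ℝ) (h : L2 Ω) : Prop :=
  ∃ S : ℝ → L2 Ω →L[ℝ] L2 Ω, Generates (outputInjection A C h) S ∧
    IsRegionallyGradientStable ω (outputInjection A C h) S

/-- General asymptotic regional gradient observer.  For the system
`x' = A x + B u`, `y = C x` on `L²(Ω)`, the dynamical system `z' = F z + G u + H y`, where
`H : ℝ → L²(Ω)` is `y ↦ y h`, is a general asymptotic regional gradient observer on `ω`
relative to the bounded operator `T`. -/
def IsGAObserver {Ω : Set (ℝ × ℝ)} (ω : Set (ℝ × ℝ))
    {V : Type*} [NormedAddCommGroup V] [NormedSpace ℝ V]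
    (A : L2 Ω → L2 Ω → Prop) (B : V →L[ℝ] L2 Ω) (C : L2 Ω → ℝ)
    (F : L2 Ω → L2 Ω → Prop) (G : V →L[ℝ] L2 Ω) (h : L2 Ω)
    (T : L2 Ω →L[ℝ] L2 Ω) : Prop :=
  -- `T` maps `D(A)` into `D(F)`, and `T A - F T = H C` on `D(A)`
  (∀ v g : L2 Ω, A v g → F (T v) (T g - C v • h)) ∧
  -- `G = T B`
  G = T.comp B ∧
  -- `M C + N χ_ω ∇ T = χ_ω ∇` on `D(A)` for some bounded `M`, `N`
  (∃ (M : ℝ →L[ℝ] H1Sq ω) (N : H1Sq ω →L[ℝ] H1Sq ω), ∀ v g : L2 Ω, A v g →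
    ∃ P Q : H1Sq ω, IsRegionalGradient ω (T v) P ∧ IsRegionalGradient ω v Q ∧
      M (C v) + N P = Q) ∧
  -- well-posedness, stability, and convergence of the estimate
  ∃ SA SF : ℝ → L2 Ω →L[ℝ] L2 Ω,
    Generates A SA ∧ Generates F SF ∧ IsRegionallyGradientStable ω F SF ∧
    ∀ (x₀ z₀ : L2 Ω) (u : ℝ → V),
      (∀ τ : ℝ, 0 < τ → MemLp u 2 (volume.restrict (Ioc 0 τ))) →
      ∀ x z : ℝ → L2 Ω,
        (∀ t : ℝ, 0 ≤ t → x t = mildSolution SA (fun τ => B (u τ)) x₀ t) →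
        (∀ t : ℝ, 0 ≤ t → z t = mildSolution SF (fun τ => G (u τ) + C (x τ) • h) z₀ t) →
        ∃ e : ℝ → H1Sq ω,
          (∀ t : ℝ, 0 < t → IsRegionalGradient ω (z t - T (x t)) (e t)) ∧
          Tendsto e atTop (𝓝 0)

end GradientObserver

end

noncomputable section

namespace GradientObserver

/-! ### Strongly continuous semigroups -/

section Semigroup

variable {E : Type*} [NormedAddCommGroup E] [NormedSpace ℝ E] {A F : E → E → Prop}
  {S T : ℝ → E →L[ℝ] E}

/-! On a rectangle the Dirichlet Laplacian is diagonal in the basis of sine products, with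
eigenvalues `-λₙ` and `λₙ ≥ (π/a₁)² > 0` (`sineBasis`, `dirichletLaplacian_iff`). Differentiating
the sine series twice multiplies its coefficients by at most `λₙ`, so `v ∈ D(A)` has all second weak
derivatives, and `∇v` is bounded in `H¹` by `‖Av‖` (`exists_weak_hessian`). As `A` commutes with the
heat semigroup and that semigroup decays, the gradient decays at the rate of the spectral gap. Thus
the zero gain is already stabilizing.

For an arbitrary stabilizing gain let `S` be the semigroup of `A - HC`. With `T = I` the algebraic
conditions are immediate (`M = 0`, `N = I`), and what remains is the error. Duhamel's formula for
the rank one perturbation and Fubini's theorem give `z(t) - x(t) = S(t)(z₀ - x₀)` for mild solutions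
(`Generates.apply_eq_add_integral`, `mildSolution_eq_of_perturbation`).

Stability only speaks of initial data in the domain, while `z₀ - x₀` is arbitrary, so a smoothing
property is needed: `S(t)v ∈ D(A)` for `t > 0`. Duhamel's formula writes `S(t)v` as a heat
evolution, which is smooth, plus a convolution of a continuous scalar with the heat evolution of
`h`. The latter lies in `D(A)` because `λ ∫ e^{-λ(t-s)} ds ≤ 1` (`exists_isDiagonalImage_integral`).
The stability estimate is then applied from time `1` on. -/

theorem IsC0Semigroup.exists_norm_le [CompleteSpace E] (hS : IsC0Semigroup S) (b : ℝ) :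
    ∃ M : ℝ, 0 ≤ M ∧ ∀ t ∈ Icc 0 b, ‖S t‖ ≤ M := by
  obtain ⟨M, hM⟩ := banach_steinhaus (g := fun t : Icc (0 : ℝ) b => S t) fun v => by
    obtain ⟨C, hC⟩ := isCompact_Icc.exists_bound_of_continuousOn
      ((hS.2.2 v).mono (Icc_subset_Ici_self : Icc 0 b ⊆ Ici 0))
    exact ⟨C, fun t => hC t t.2⟩
  exact ⟨max M 0, le_max_right _ _, fun t ht => (hM ⟨t, ht⟩).trans (le_max_left _ _)⟩

/-- The semigroup, extended to negative times by the identity, is jointly continuous. -/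
theorem IsC0Semigroup.continuous_uncurry [CompleteSpace E] (hS : IsC0Semigroup S) :
    Continuous fun p : ℝ × E => S (max p.1 0) p.2 := by
  rw [continuous_iff_continuousAt]
  rintro ⟨t, v⟩
  obtain ⟨M, hM0, hM⟩ := hS.exists_norm_le (|t| + 1)
  have h1 : Continuous fun s : ℝ => S (max s 0) v :=
    (hS.2.2 v).comp_continuous (continuous_id.max continuous_const) fun s =>
      mem_Ici.2 (le_max_right _ _)
  -- Split `S(s)w = S(s)(w - v) + S(s)v`: local boundedness controls the first term, strong
  -- continuity the second.
  have h2 : Tendsto (fun p : ℝ × E => S (max p.1 0) (p.2 - v)) (𝓝 (t, v)) (𝓝 0) := by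
    have h3 : Tendsto (fun p : ℝ × E => M * ‖p.2 - v‖) (𝓝 (t, v)) (𝓝 0) := by
      have : Continuous fun p : ℝ × E => M * ‖p.2 - v‖ := by fun_prop
      simpa using this.tendsto (t, v)
    refine squeeze_zero_norm' ?_ h3
    have h4 : ∀ᶠ p : ℝ × E in 𝓝 (t, v), p.1 < |t| + 1 :=
      (continuous_fst.tendsto (t, v)).eventually
        (Iio_mem_nhds (by have := le_abs_self t; linarith : t < |t| + 1))
    filter_upwards [h4] with p hp
    exact (S _).le_of_opNorm_le
      (hM _ ⟨le_max_right _ _, max_le hp.le (by positivity)⟩) _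
  have h5 := h2.add ((h1.comp continuous_fst).tendsto (t, v))
  simp only [map_sub, Function.comp_apply, sub_add_cancel, zero_add] at h5
  exact h5

theorem Generates.map_apply (hS : Generates A S) {v g : E} (hv : A v g) {t : ℝ} (ht : 0 ≤ t) :
    A (S t v) (S t g) := by
  rw [hS.2]
  have h1 := ((S t).continuous.tendsto g).comp ((hS.2 v g).1 hv)
  refine h1.congr' ?_
  filter_upwards [self_mem_nhdsWithin] with s hs
  have hs : (0 : ℝ) < s := hs
  have h2 : S s (S t v) = S t (S s v) := by
    rw [← ContinuousLinearMap.comp_apply, ← ContinuousLinearMap.comp_apply,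
      ← hS.1.2.1 s t hs.le ht, ← hS.1.2.1 t s ht hs.le, add_comm]
  simp [h2]

theorem tendsto_sub_nhdsGT (s : ℝ) : Tendsto (fun r : ℝ => r - s) (𝓝[>] s) (𝓝[>] 0) := by
  refine tendsto_nhdsWithin_iff.2 ⟨?_, ?_⟩
  · have : Continuous fun r : ℝ => r - s := by fun_prop
    simpa using (this.tendsto s).mono_left nhdsWithin_le_nhds
  · filter_upwards [self_mem_nhdsWithin] with r hr
    exact sub_pos.2 (mem_Ioi.1 hr)

/-- Variation of parameters for a rank one perturbation, on the domain of the generator. -/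
theorem Generates.apply_eq_add_integral_of_mem [CompleteSpace E] (hS : Generates A S)
    (hT : Generates F T)
    (c : E →L[ℝ] ℝ) (h : E) (hAF : ∀ v g, A v g → F v (g - c v • h)) {v g : E} (hv : A v g)
    {t : ℝ} (ht : 0 ≤ t) :
    S t v = T t v + ∫ s in (0 : ℝ)..t, c (S (max s 0) v) • T (max (t - s) 0) h := by
  -- `φ` runs from `T(t)v` to `S(t)v`, with derivative `T(t-s)(A - F)S(s)v`, in which only the rank
  -- one term survives.
  set φ : ℝ → E := fun s => T (max (t - s) 0) (S (max s 0) v) with hφ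
  have hSv : Continuous fun s : ℝ => S (max s 0) v :=
    hS.1.continuous_uncurry.comp (continuous_id.prodMk continuous_const)
  have hTh : Continuous fun s : ℝ => T (max (t - s) 0) h :=
    hT.1.continuous_uncurry.comp ((continuous_const.sub continuous_id).prodMk continuous_const)
  have hφc : Continuous φ :=
    hT.1.continuous_uncurry.comp ((continuous_const.sub continuous_id).prodMk hSv)
  -- Generators are defined by one-sided limits, so only a right derivative is available; with
  -- continuity of `φ` this suffices for the fundamental theorem of calculus.
  have hder : ∀ s ∈ Ioo (min 0 t) (max 0 t), HasDerivWithinAt φ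
      (c (S (max s 0) v) • T (max (t - s) 0) h) (Ioi s) s := by
    intro s hs
    rw [min_eq_left ht, max_eq_right ht] at hs
    rw [hasDerivWithinAt_iff_tendsto_slope' (by simp)]
    have hA := hS.map_apply hv hs.1.le
    have h1 := ((hS.2 _ _).1 hA).comp (tendsto_sub_nhdsGT s)
    have h2 := ((hT.2 _ _).1 (hAF _ _ hA)).comp (tendsto_sub_nhdsGT s)
    have h3 := h1.sub h2
    rw [sub_sub_cancel] at h3
    have h4 : Tendsto (fun r : ℝ => t - r) (𝓝[>] s) (𝓝 (t - s)) :=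
      ((continuous_const.sub continuous_id).tendsto s).mono_left nhdsWithin_le_nhds
    have h5 := (hT.1.continuous_uncurry.tendsto (t - s, c (S s v) • h)).comp (h4.prodMk_nhds h3)
    simp only [max_eq_left hs.1.le, ← map_smul]
    refine h5.congr' ?_
    filter_upwards [self_mem_nhdsWithin, nhdsWithin_le_nhds (Iio_mem_nhds hs.2)] with r hr hrt
    have hr : s < r := hr
    have hrt : r < t := hrt
    have e1 : S r v = S (r - s) (S s v) := by
      rw [← ContinuousLinearMap.comp_apply, ← hS.1.2.1 _ _ (sub_pos.2 hr).le hs.1.le,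
        sub_add_cancel]
    have e2 : T (t - s) (S s v) = T (t - r) (T (r - s) (S s v)) := by
      rw [← ContinuousLinearMap.comp_apply (T (t - r)), ← hT.1.2.1 _ _ (sub_pos.2 hrt).le
        (sub_pos.2 hr).le, sub_add_sub_cancel]
    simp only [slope, hφ, Function.comp_apply, vsub_eq_sub]
    rw [max_eq_left (sub_pos.2 hrt).le, max_eq_left (sub_pos.2 hs.2).le, max_eq_left hs.1.le,
      max_eq_left (hs.1.trans hr).le, e2, e1, ← smul_sub, map_smul]
    simp
  have hint := intervalIntegral.integral_eq_sub_of_hasDeriv_right (a := 0) (b := t)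
    hφc.continuousOn hder
    (((c.continuous.comp hSv).smul hTh).intervalIntegrable _ _)
  rw [hint]
  simp [hφ, hS.1.1, hT.1.1, ht]

/-- Variation of parameters for a rank one perturbation. -/
theorem Generates.apply_eq_add_integral [CompleteSpace E] (hS : Generates A S)
    (hT : Generates F T) (hA : Dense {v | ∃ g, A v g})
    (c : E →L[ℝ] ℝ) (h : E) (hAF : ∀ v g, A v g → F v (g - c v • h)) (v : E)
    {t : ℝ} (ht : 0 ≤ t) :
    S t v = T t v + ∫ s in (0 : ℝ)..t, c (S (max s 0) v) • T (max (t - s) 0) h := by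
  have hTh : Continuous fun s : ℝ => T (max (t - s) 0) h :=
    hT.1.continuous_uncurry.comp ((continuous_const.sub continuous_id).prodMk continuous_const)
  have hI : Continuous fun v : E =>
      ∫ s in (0 : ℝ)..t, c (S (max s 0) v) • T (max (t - s) 0) h := by
    refine intervalIntegral.continuous_parametric_intervalIntegral_of_continuous' ?_ _ _
    exact (c.continuous.comp (hS.1.continuous_uncurry.comp continuous_swap)).smul
      (hTh.comp continuous_snd)
  -- Both sides are continuous in `v`, so the identity passes from the dense domain to all of `E`.
  have hcl : IsClosed {v : E | S t v = T t v +
      ∫ s in (0 : ℝ)..t, c (S (max s 0) v) • T (max (t - s) 0) h} :=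
    isClosed_eq (S t).continuous ((T t).continuous.add hI)
  refine closure_minimal ?_ hcl (hA v)
  rintro w ⟨g, hg⟩
  exact hS.apply_eq_add_integral_of_mem hT c h hAF hg ht

/-- A mild solution for the semigroup `S` is also a mild solution for the semigroup `T` of a rank
one perturbation, the perturbation being moved into the inhomogeneity. -/
theorem mildSolution_eq_of_perturbation [CompleteSpace E] (hS : IsC0Semigroup S)
    (hT : IsC0Semigroup T)
    (c : E →L[ℝ] ℝ) (h : E) (hST : ∀ v, ∀ t : ℝ, 0 ≤ t →
      S t v = T t v + ∫ s in (0 : ℝ)..t, c (S (max s 0) v) • T (max (t - s) 0) h)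
    {b : ℝ → E} {t : ℝ} (ht : 0 ≤ t) (hb : IntegrableOn b (Ioc 0 t)) {x : ℝ → E} {x₀ : E}
    (hx : ∀ τ, 0 ≤ τ → x τ = mildSolution S b x₀ τ) (z₀ : E) :
    mildSolution T (fun τ => b τ + c (x τ) • h) z₀ t - x t = T t (z₀ - x₀) := by
  set μ : Measure ℝ := volume.restrict (Ioc 0 t) with hμ
  have hb' : Integrable b μ := hb
  obtain ⟨M, hM0, hM⟩ := hS.exists_norm_le t
  obtain ⟨N, hN0, hN⟩ := hT.exists_norm_le t
  have hTh : Continuous fun s : ℝ => T (max (t - s) 0) h :=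
    hT.continuous_uncurry.comp ((continuous_const.sub continuous_id).prodMk continuous_const)
  have hSx : Continuous fun s : ℝ => S (max s 0) x₀ :=
    hS.continuous_uncurry.comp (continuous_id.prodMk continuous_const)
  -- the kernel on the square, supported in the triangle `σ ≤ τ`
  set K : ℝ × ℝ → E := {p : ℝ × ℝ | p.1 ≤ p.2}.indicator
    (fun p => c (S (max (p.2 - p.1) 0) (b p.1)) • T (max (t - p.2) 0) h) with hK
  have htri : MeasurableSet {p : ℝ × ℝ | p.1 ≤ p.2} :=
    measurableSet_le measurable_fst measurable_snd
  have hKint : Integrable K (μ.prod μ) := by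
    have hdom : Integrable (fun p : ℝ × ℝ => ‖c‖ * (M * ‖b p.1‖) * (N * ‖h‖)) (μ.prod μ) := by
      have := (hb'.norm.comp_fst μ).const_mul (‖c‖ * M * (N * ‖h‖))
      refine this.congr (Eventually.of_forall fun p => ?_)
      simp only; ring
    refine hdom.mono' (AEStronglyMeasurable.indicator ?_ htri) ?_
    · refine AEStronglyMeasurable.smul ?_ (hTh.comp continuous_snd).aestronglyMeasurable
      have h1 : AEStronglyMeasurable (fun p : ℝ × ℝ => ((p.2 - p.1), b p.1)) (μ.prod μ) :=
        ((continuous_snd.sub continuous_fst).aestronglyMeasurable).prodMk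
          hb'.aestronglyMeasurable.comp_fst
      exact (c.continuous.comp hS.continuous_uncurry).comp_aestronglyMeasurable h1
    · have h1 : ∀ᵐ p ∂(μ.prod μ), p ∈ Ioc 0 t ×ˢ Ioc 0 t := by
        rw [hμ, Measure.prod_restrict]
        exact ae_restrict_mem (measurableSet_Ioc.prod measurableSet_Ioc)
      filter_upwards [h1] with p hp
      refine (norm_indicator_le_norm_self _ _).trans ?_
      rw [norm_smul]
      have h2 : ‖S (max (p.2 - p.1) 0) (b p.1)‖ ≤ M * ‖b p.1‖ :=
        (S _).le_of_opNorm_le (hM _ ⟨le_max_right _ _,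
          max_le (by linarith [hp.1.1, hp.2.2]) ht⟩) _
      have h3 : ‖T (max (t - p.2) 0) h‖ ≤ N * ‖h‖ :=
        (T _).le_of_opNorm_le (hN _ ⟨le_max_right _ _, max_le (by linarith [hp.2.1]) ht⟩) _
      exact mul_le_mul ((c.le_opNorm _).trans (mul_le_mul_of_nonneg_left h2 (norm_nonneg _))) h3
        (norm_nonneg _) (by positivity)
  -- Integrating in `τ` first turns the kernel, by Duhamel, into the discrepancy `S - T` applied to
  -- `b σ`; integrating in `σ` first rebuilds the forced part of `c (x τ)`.
  have hswap : ∫ σ, ∫ τ, K (σ, τ) ∂μ ∂μ = ∫ τ, ∫ σ, K (σ, τ) ∂μ ∂μ :=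
    integral_integral_swap (f := fun σ τ => K (σ, τ)) hKint
  -- inner integral in `τ`
  have hin1 : ∀ σ ∈ Ioc 0 t, ∫ τ, K (σ, τ) ∂μ = S (t - σ) (b σ) - T (t - σ) (b σ) := by
    intro σ hσ
    have e1 : ∫ τ, K (σ, τ) ∂μ =
        ∫ τ in σ..t, c (S (max (τ - σ) 0) (b σ)) • T (max (t - τ) 0) h := by
      rw [intervalIntegral.integral_of_le hσ.2, hμ]
      have : (fun τ => K (σ, τ)) = (Ici σ).indicator
          (fun τ => c (S (max (τ - σ) 0) (b σ)) • T (max (t - τ) 0) h) := by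
        ext τ; simp [hK, indicator]
      rw [this, setIntegral_indicator measurableSet_Ici]
      rw [← integral_Icc_eq_integral_Ioc]
      congr 2
      ext τ; simp only [mem_inter_iff, mem_Ioc, mem_Ici, mem_Icc]
      constructor
      · rintro ⟨⟨_, h2⟩, h3⟩; exact ⟨h3, h2⟩
      · rintro ⟨h2, h3⟩; exact ⟨⟨hσ.1.trans_le h2, h3⟩, h2⟩
    have e2 := intervalIntegral.integral_comp_sub_right (a := σ) (b := t)
      (fun s => c (S (max s 0) (b σ)) • T (max (t - σ - s) 0) h) σ
    rw [hST (b σ) (t - σ) (sub_nonneg.2 hσ.2), add_sub_cancel_left, e1]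
    rw [sub_self] at e2
    rw [← e2]
    refine intervalIntegral.integral_congr fun τ _ => ?_
    simp
  -- inner integral in `σ`
  have hbS : ∀ τ, 0 ≤ τ → τ ≤ t → Integrable (fun σ => S (max (τ - σ) 0) (b σ)) μ := by
    intro τ h0 hτ
    refine (hb'.norm.const_mul M).mono' ?_ ?_
    · exact hS.continuous_uncurry.comp_aestronglyMeasurable
        ((continuous_const.sub continuous_id).aestronglyMeasurable.prodMk hb'.aestronglyMeasurable)
    · filter_upwards [ae_restrict_mem measurableSet_Ioc] with σ hσ
      exact (S _).le_of_opNorm_le (hM _ ⟨le_max_right _ _, max_le (by linarith [hσ.1]) ht⟩) _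
  have hbT : Integrable (fun σ => T (max (t - σ) 0) (b σ)) μ := by
    refine (hb'.norm.const_mul N).mono' ?_ ?_
    · exact hT.continuous_uncurry.comp_aestronglyMeasurable
        ((continuous_const.sub continuous_id).aestronglyMeasurable.prodMk hb'.aestronglyMeasurable)
    · filter_upwards [ae_restrict_mem measurableSet_Ioc] with σ hσ
      exact (T _).le_of_opNorm_le (hN _ ⟨le_max_right _ _, max_le (by linarith [hσ.1]) ht⟩) _
  have hin2 : ∀ τ ∈ Ioc 0 t, ∫ σ, K (σ, τ) ∂μ =
      c (x τ - S τ x₀) • T (max (t - τ) 0) h := by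
    intro τ hτ
    have e1 : (fun σ => K (σ, τ)) = (Iic τ).indicator
        (fun σ => c (S (max (τ - σ) 0) (b σ)) • T (max (t - τ) 0) h) := by
      ext σ; simp [hK, indicator]
    have e2 : Iic τ ∩ Ioc 0 t = Ioc 0 τ := by
      ext σ; simp only [mem_inter_iff, mem_Ioc, mem_Iic]
      constructor
      · rintro ⟨h1, h2, _⟩; exact ⟨h2, h1⟩
      · rintro ⟨h1, h2⟩; exact ⟨h2, h1, h2.trans hτ.2⟩
    rw [e1, integral_indicator measurableSet_Iic, hμ, Measure.restrict_restrict measurableSet_Iic,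
      e2, integral_smul_const]
    congr 1
    have h1 : IntegrableOn (fun σ => S (max (τ - σ) 0) (b σ)) (Ioc 0 τ) := by
      have : IntegrableOn (fun σ => S (max (τ - σ) 0) (b σ)) (Ioc 0 t) := hbS τ hτ.1.le hτ.2
      exact this.mono_set (Ioc_subset_Ioc_right hτ.2)
    rw [c.integral_comp_comm h1, hx τ hτ.1.le, mildSolution, add_sub_cancel_left,
      intervalIntegral.integral_of_le hτ.1.le]
    congr 1
    refine setIntegral_congr_fun measurableSet_Ioc fun σ hσ => ?_
    simp only [max_eq_left (sub_nonneg.2 hσ.2)]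
  have hcS : Integrable (fun τ => c (S τ x₀) • T (max (t - τ) 0) h) μ := by
    have : IntegrableOn (fun τ => c (S (max τ 0) x₀) • T (max (t - τ) 0) h) (Ioc 0 t) :=
      (((c.continuous.comp hSx).smul hTh).integrableOn_Icc (a := 0) (b := t)).mono_set
        Ioc_subset_Icc_self
    refine this.congr_fun (fun τ hτ => ?_) measurableSet_Ioc
    simp only [max_eq_left hτ.1.le]
  -- No measurability of `x` is assumed; integrability is inherited from the kernel through Fubini.
  have hcI : Integrable (fun τ => c (x τ - S τ x₀) • T (max (t - τ) 0) h) μ := by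
    refine (hKint.integral_prod_right).congr ?_
    filter_upwards [ae_restrict_mem measurableSet_Ioc] with τ hτ using hin2 τ hτ
  have hcx : Integrable (fun τ => c (x τ) • T (max (t - τ) 0) h) μ := by
    refine (hcI.add hcS).congr (Eventually.of_forall fun τ => ?_)
    simp [← add_smul]
  have hmain : ∫ τ, T (max (t - τ) 0) (b τ + c (x τ) • h) ∂μ =
      ∫ τ, T (max (t - τ) 0) (b τ) ∂μ + (∫ τ, c (x τ - S τ x₀) • T (max (t - τ) 0) h ∂μ +
        ∫ τ, c (S τ x₀) • T (max (t - τ) 0) h ∂μ) := by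
    have h1 := integral_add hcI hcS
    have h2 := integral_add hbT hcx
    simp only [← add_smul, ← map_add, sub_add_cancel] at h1
    rw [← h1, ← h2]
    simp only [map_add, map_smul]
  have e1 : ∫ τ, c (x τ - S τ x₀) • T (max (t - τ) 0) h ∂μ =
      ∫ σ, S (max (t - σ) 0) (b σ) ∂μ - ∫ σ, T (max (t - σ) 0) (b σ) ∂μ := by
    rw [← integral_sub (hbS t ht le_rfl) hbT]
    rw [setIntegral_congr_fun measurableSet_Ioc fun τ hτ => (hin2 τ hτ).symm, ← hswap]
    refine setIntegral_congr_fun measurableSet_Ioc fun σ hσ => ?_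
    simp only [hin1 σ hσ, max_eq_left (sub_nonneg.2 hσ.2)]
  have e2 : ∫ τ, c (S τ x₀) • T (max (t - τ) 0) h ∂μ = S t x₀ - T t x₀ := by
    rw [hST x₀ t ht, add_sub_cancel_left, intervalIntegral.integral_of_le ht]
    refine setIntegral_congr_fun measurableSet_Ioc fun τ hτ => ?_
    simp only [max_eq_left hτ.1.le]
  have hz : mildSolution T (fun τ => b τ + c (x τ) • h) z₀ t =
      T t z₀ + ∫ τ, T (max (t - τ) 0) (b τ + c (x τ) • h) ∂μ := by
    rw [mildSolution, intervalIntegral.integral_of_le ht]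
    congr 1
    refine setIntegral_congr_fun measurableSet_Ioc fun τ hτ => ?_
    simp only [max_eq_left (sub_nonneg.2 hτ.2)]
  have hxt : x t = S t x₀ + ∫ τ, S (max (t - τ) 0) (b τ) ∂μ := by
    rw [hx t ht, mildSolution, intervalIntegral.integral_of_le ht]
    congr 1
    refine setIntegral_congr_fun measurableSet_Ioc fun τ hτ => ?_
    simp only [max_eq_left (sub_nonneg.2 hτ.2)]
  rw [hz, hxt, hmain, e1, e2, map_sub]
  abel

end Semigroup

/-! ### Diagonal operators in a Hilbert basis -/

section Diagonal

variable {ι E : Type*} [NormedAddCommGroup E] [InnerProductSpace ℝ E]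

/-- Riesz–Fischer and Parseval. Completeness of the family is not required, so this also serves the
mixed sine-cosine products that arise as derivatives. -/
theorem exists_hasSum_of_orthonormal [CompleteSpace E] {φ : ι → E} (hφ : Orthonormal ℝ φ)
    {c : ι → ℝ} (hc : Summable fun n => c n ^ 2) :
    ∃ u, HasSum (fun n => c n • φ n) u ∧ HasSum (fun n => c n ^ 2) (‖u‖ ^ 2) := by
  have h1 : Summable fun n => c n • φ n := by
    have := (hφ.orthogonalFamily.summable_iff_norm_sq_summable c).2 (by simpa using hc)
    simpa using this
  obtain ⟨u, hu⟩ := h1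
  refine ⟨u, hu, ?_⟩
  have h2 : Tendsto (fun s : Finset ι => ‖∑ n ∈ s, c n • φ n‖ ^ 2) atTop (𝓝 (‖u‖ ^ 2)) :=
    hu.norm.pow 2
  refine h2.congr fun s => ?_
  have := hφ.orthogonalFamily.norm_sum c s
  simpa using this

variable (b : HilbertBasis ι ℝ E)

theorem hilbertBasis_ext {u v : E} (h : ∀ n, inner ℝ (b n) u = inner ℝ (b n) v) : u = v := by
  refine b.repr.injective (lp.ext (funext fun n => ?_))
  simpa only [HilbertBasis.repr_apply_apply] using h n

theorem hilbertBasis_hasSum_sq (v : E) : HasSum (fun n => inner ℝ (b n) v ^ 2) (‖v‖ ^ 2) := by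
  have h := b.hasSum_inner_mul_inner v v
  rw [real_inner_self_eq_norm_sq] at h
  refine h.congr_fun fun n => ?_
  rw [real_inner_comm, sq]

theorem hilbertBasis_exists_inner_eq [CompleteSpace E] {c : ι → ℝ}
    (hc : Summable fun n => c n ^ 2) : ∃ u, ∀ n, inner ℝ (b n) u = c n := by
  obtain ⟨u, hu, -⟩ := exists_hasSum_of_orthonormal b.orthonormal hc
  refine ⟨u, fun n => ?_⟩
  classical
  have h1 := hu.mapL (innerSL ℝ (b n))
  refine h1.unique ?_
  have h2 : HasSum (fun m => if m = n then c m else 0) (c n) := hasSum_ite_eq n (c n) |>.congr_fun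
    fun m => by split_ifs with h <;> simp [h]
  refine h2.congr_fun fun m => ?_
  have := orthonormal_iff_ite.1 b.orthonormal n m
  simp only [map_smul, innerSL_apply_apply, this, smul_eq_mul, eq_comm (a := n)]
  split_ifs <;> simp

/-- Dominated convergence in coordinates. -/
theorem tendsto_of_tendsto_inner {α : Type*} {l : Filter α} {f : α → E} {u : E} {B : ι → ℝ}
    (hB : Summable fun n => B n ^ 2)
    (hfB : ∀ᶠ a in l, ∀ n, |inner ℝ (b n) (f a) - inner ℝ (b n) u| ≤ B n)
    (hf : ∀ n, Tendsto (fun a => inner ℝ (b n) (f a)) l (𝓝 (inner ℝ (b n) u))) :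
    Tendsto f l (𝓝 u) := by
  rw [tendsto_iff_norm_sub_tendsto_zero]
  have h1 : Tendsto (fun a => ∑' n, inner ℝ (b n) (f a - u) ^ 2) l (𝓝 (∑' _ : ι, (0 : ℝ))) := by
    refine tendsto_tsum_of_dominated_convergence hB (fun n => ?_) ?_
    · have := ((hf n).sub_const (inner ℝ (b n) u)).pow 2
      simpa [inner_sub_right] using this
    · filter_upwards [hfB] with a ha n
      rw [inner_sub_right, norm_pow, Real.norm_eq_abs]
      exact pow_le_pow_left₀ (abs_nonneg _) (ha n) 2
  simp only [(hilbertBasis_hasSum_sq b _).tsum_eq, tsum_zero] at h1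
  have h2 := h1.sqrt
  simpa [Real.sqrt_sq (norm_nonneg _)] using h2

theorem summable_mul_inner_sq {d : ι → ℝ} {K : ℝ} (hd : ∀ n, |d n| ≤ K) (v : E) :
    Summable fun n => (d n * inner ℝ (b n) v) ^ 2 := by
  refine Summable.of_nonneg_of_le (fun n => sq_nonneg _) (fun n => ?_)
    ((hilbertBasis_hasSum_sq b v).summable.mul_left (K ^ 2))
  rw [mul_pow]
  exact mul_le_mul_of_nonneg_right (sq_le_sq' (abs_le.1 (hd n)).1 (abs_le.1 (hd n)).2)
    (sq_nonneg _)

theorem norm_le_of_abs_inner_le {K : ℝ} (hK : 0 ≤ K) {u v : E}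
    (h : ∀ n, |inner ℝ (b n) u| ≤ K * |inner ℝ (b n) v|) : ‖u‖ ≤ K * ‖v‖ := by
  refine le_of_sq_le_sq ?_ (by positivity)
  rw [mul_pow]
  refine hasSum_le (fun n => ?_) (hilbertBasis_hasSum_sq b u)
    ((hilbertBasis_hasSum_sq b v).mul_left (K ^ 2))
  rw [← mul_pow, ← sq_abs, ← sq_abs (K * _), abs_mul K, abs_of_nonneg hK]
  exact pow_le_pow_left₀ (abs_nonneg _) (h n) 2

variable [CompleteSpace E]

/-- The bounded operator with eigenvectors `b n` and eigenvalues `d n`. -/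
def diagonal (d : ι → ℝ) (K : ℝ) (hd : ∀ n, |d n| ≤ K) : E →L[ℝ] E :=
  have hex := fun v => hilbertBasis_exists_inner_eq b (summable_mul_inner_sq b hd v)
  LinearMap.mkContinuous
    { toFun := fun v => (hex v).choose
      map_add' := fun u v => hilbertBasis_ext b fun n => by
        rw [inner_add_right, (hex _).choose_spec, (hex _).choose_spec, (hex _).choose_spec,
          inner_add_right, mul_add]
      map_smul' := fun r v => hilbertBasis_ext b fun n => by
        -- The bound is `|K|` because `hd` does not make `K` nonnegative when `ι` is empty.
        rw [RingHom.id_apply, inner_smul_right, (hex _).choose_spec, (hex _).choose_spec,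
          inner_smul_right, mul_left_comm] } |K| fun v => by
    refine norm_le_of_abs_inner_le b (abs_nonneg K) fun n => ?_
    rw [LinearMap.coe_mk, AddHom.coe_mk, (hex _).choose_spec, abs_mul]
    exact mul_le_mul_of_nonneg_right ((hd n).trans (le_abs_self K)) (abs_nonneg _)

theorem inner_diagonal (d : ι → ℝ) (K : ℝ) (hd : ∀ n, |d n| ≤ K) (v : E) (n : ι) :
    inner ℝ (b n) (diagonal b d K hd v) = d n * inner ℝ (b n) v :=
  (hilbertBasis_exists_inner_eq b (summable_mul_inner_sq b hd v)).choose_spec n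

/-- The graph of the unbounded operator with eigenvectors `b n` and eigenvalues `-lam n`. -/
def IsDiagonalImage (b : HilbertBasis ι ℝ E) (lam : ι → ℝ) (v g : E) : Prop :=
  ∀ n, inner ℝ (b n) g = -lam n * inner ℝ (b n) v

/-- Clamping time at `0` keeps the multipliers bounded for every real `t`, so the operators can be
defined on the whole line. -/
theorem abs_exp_neg_mul_le {x t : ℝ} (hx : 0 ≤ x) : |Real.exp (-(x * max t 0))| ≤ 1 := by
  rw [Real.abs_exp, Real.exp_le_one_iff, neg_nonpos]
  exact mul_nonneg hx (le_max_right _ _)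

variable {lam : ι → ℝ} (hlam : ∀ n, 0 ≤ lam n)

/-- The semigroup of contractions `e^{-t lam}`. -/
def diagonalSemigroup (t : ℝ) : E →L[ℝ] E :=
  diagonal b (fun n => Real.exp (-(lam n * max t 0))) 1 fun n => abs_exp_neg_mul_le (hlam n)

theorem inner_diagonalSemigroup (t : ℝ) (v : E) (n : ι) :
    inner ℝ (b n) (diagonalSemigroup b hlam t v) =
      Real.exp (-(lam n * max t 0)) * inner ℝ (b n) v :=
  inner_diagonal b _ _ _ v n

theorem isC0Semigroup_diagonalSemigroup : IsC0Semigroup (diagonalSemigroup b hlam) := by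
  refine ⟨?_, ?_, fun v => ?_⟩
  · ext v
    refine hilbertBasis_ext b fun n => ?_
    simp [inner_diagonalSemigroup]
  · intro s t hs ht
    ext v
    refine hilbertBasis_ext b fun n => ?_
    rw [ContinuousLinearMap.comp_apply, inner_diagonalSemigroup, inner_diagonalSemigroup,
      inner_diagonalSemigroup, max_eq_left hs, max_eq_left ht, max_eq_left (add_nonneg hs ht),
      ← mul_assoc, ← Real.exp_add]
    congr 2; ring
  · refine Continuous.continuousOn (continuous_iff_continuousAt.2 fun t => ?_)
    refine tendsto_of_tendsto_inner b (B := fun n => 2 * |inner ℝ (b n) v|) ?_ ?_ fun n => ?_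
    · simpa [mul_pow] using (hilbertBasis_hasSum_sq b v).summable.mul_left (2 ^ 2)
    · refine Eventually.of_forall fun s n => ?_
      rw [inner_diagonalSemigroup, inner_diagonalSemigroup, ← sub_mul, abs_mul]
      refine mul_le_mul_of_nonneg_right ((abs_sub _ _).trans ?_) (abs_nonneg _)
      linarith [abs_exp_neg_mul_le (t := s) (hlam n), abs_exp_neg_mul_le (t := t) (hlam n)]
    · simp only [inner_diagonalSemigroup]
      have : Continuous fun s => Real.exp (-(lam n * max s 0)) * inner ℝ (b n) v := by fun_prop
      exact this.tendsto t

/-! ### Generator, smoothing and decay of a diagonal semigroup. -/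

theorem tendsto_inv_mul_exp_sub_one (x : ℝ) :
    Tendsto (fun t : ℝ => t⁻¹ * (Real.exp (-(x * t)) - 1)) (𝓝[>] 0) (𝓝 (-x)) := by
  have h : HasDerivAt (fun t : ℝ => Real.exp (-(x * t))) (-x) 0 := by
    have h1 : HasDerivAt (fun t : ℝ => -(x * t)) (-x) 0 := by
      simpa using (hasDerivAt_id (0 : ℝ)).const_mul (-x)
    simpa using h1.exp
  have h2 := h.tendsto_slope_zero_right
  simpa using h2

/-- From `1 - xt ≤ e^{-xt} ≤ 1`. Uniformity in `t` supplies the majorant for the difference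
quotients. -/
theorem abs_inv_mul_exp_sub_one_le {x t : ℝ} (hx : 0 ≤ x) (ht : 0 < t) :
    |t⁻¹ * (Real.exp (-(x * t)) - 1)| ≤ x := by
  rw [abs_mul, abs_of_pos (inv_pos.2 ht), inv_mul_le_iff₀ ht, abs_le]
  have h1 := Real.add_one_le_exp (-(x * t))
  have h2 : Real.exp (-(x * t)) ≤ 1 := by
    rw [Real.exp_le_one_iff, neg_nonpos]; positivity
  constructor <;> nlinarith [mul_nonneg hx ht.le]

/-- If the diagonal image `g` exists, the quotients converge coordinatewise, dominated by a multiple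
of the coordinates of `g`. Conversely, norm convergence forces the limit of each coordinate. -/
theorem generates_diagonalSemigroup :
    Generates (IsDiagonalImage b lam) (diagonalSemigroup b hlam) := by
  refine ⟨isC0Semigroup_diagonalSemigroup b hlam, fun v g => ?_⟩
  have key : ∀ t : ℝ, 0 < t → ∀ n,
      inner ℝ (b n) (t⁻¹ • (diagonalSemigroup b hlam t v - v)) =
        t⁻¹ * (Real.exp (-(lam n * t)) - 1) * inner ℝ (b n) v := by
    intro t ht n
    rw [inner_smul_right, inner_sub_right, inner_diagonalSemigroup, max_eq_left ht.le]
    ring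
  have hlim : ∀ n, Tendsto (fun t : ℝ => inner ℝ (b n) (t⁻¹ • (diagonalSemigroup b hlam t v - v)))
      (𝓝[>] 0) (𝓝 (-lam n * inner ℝ (b n) v)) := by
    intro n
    refine ((tendsto_inv_mul_exp_sub_one (lam n)).mul_const (inner ℝ (b n) v)).congr' ?_
    filter_upwards [self_mem_nhdsWithin] with t ht
    rw [key t ht]
  constructor
  · intro h
    refine tendsto_of_tendsto_inner b (B := fun n => 2 * |inner ℝ (b n) g|) ?_ ?_ fun n => ?_
    · simpa [mul_pow] using (hilbertBasis_hasSum_sq b g).summable.mul_left (2 ^ 2)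
    · filter_upwards [self_mem_nhdsWithin] with t ht n
      rw [key t ht, h n, ← sub_mul, abs_mul, abs_mul, abs_neg, abs_of_nonneg (hlam n), ← mul_assoc]
      refine mul_le_mul_of_nonneg_right ((abs_sub _ _).trans ?_) (abs_nonneg _)
      rw [abs_neg, abs_of_nonneg (hlam n)]
      linarith [abs_inv_mul_exp_sub_one_le (hlam n) (mem_Ioi.1 ht)]
    · rw [h n]; exact hlim n
  · intro h n
    exact tendsto_nhds_unique (((innerSL ℝ (b n)).continuous.tendsto g).comp h) (hlim n)

theorem exists_isDiagonalImage_iff (v : E) :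
    (∃ g, IsDiagonalImage b lam v g) ↔ Summable fun n => (lam n * inner ℝ (b n) v) ^ 2 := by
  constructor
  · rintro ⟨g, hg⟩
    refine (hilbertBasis_hasSum_sq b g).summable.congr fun n => ?_
    rw [hg n]; ring
  · intro h
    obtain ⟨g, hg⟩ := hilbertBasis_exists_inner_eq b (c := fun n => -lam n * inner ℝ (b n) v)
      (h.congr fun n => by ring)
    exact ⟨g, hg⟩

/-- Smoothing: `λ e^{-λt} ≤ 1/t` for every `λ ≥ 0`. -/
theorem exists_isDiagonalImage_diagonalSemigroup {t : ℝ} (ht : 0 < t) (v : E) :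
    ∃ g, IsDiagonalImage b lam (diagonalSemigroup b hlam t v) g := by
  rw [exists_isDiagonalImage_iff]
  have hd : ∀ n, |lam n * Real.exp (-(lam n * t))| ≤ t⁻¹ := by
    intro n
    rw [abs_of_nonneg (mul_nonneg (hlam n) (Real.exp_pos _).le), Real.exp_neg,
      ← div_eq_mul_inv, div_le_iff₀ (Real.exp_pos _), le_inv_mul_iff₀ ht]
    linarith [Real.add_one_le_exp (lam n * t), mul_comm t (lam n)]
  refine (summable_mul_inner_sq b hd v).congr fun n => ?_
  rw [inner_diagonalSemigroup, max_eq_left ht.le, mul_assoc]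

/-- Each `v` is the limit of its own smooth evolution as `t → 0+`. -/
theorem dense_domain_isDiagonalImage (hlam : ∀ n, 0 ≤ lam n) :
    Dense {v | ∃ g, IsDiagonalImage b lam v g} := by
  intro v
  have h1 := ((isC0Semigroup_diagonalSemigroup b hlam).2.2 v 0 self_mem_Ici).mono_left
    (nhdsWithin_mono 0 Ioi_subset_Ici_self)
  simp only [(isC0Semigroup_diagonalSemigroup b hlam).1, ContinuousLinearMap.id_apply] at h1
  refine mem_closure_of_tendsto h1 ?_
  filter_upwards [self_mem_nhdsWithin] with t ht
  exact exists_isDiagonalImage_diagonalSemigroup b hlam ht v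

theorem norm_diagonalSemigroup_apply_le {k : ℝ} (hk : ∀ n, k ≤ lam n) {t : ℝ} (ht : 0 ≤ t)
    (v : E) : ‖diagonalSemigroup b hlam t v‖ ≤ Real.exp (-(k * t)) * ‖v‖ := by
  refine norm_le_of_abs_inner_le b (Real.exp_pos _).le fun n => ?_
  rw [inner_diagonalSemigroup, abs_mul, Real.abs_exp, max_eq_left ht]
  refine mul_le_mul_of_nonneg_right (Real.exp_le_exp.2 ?_) (abs_nonneg _)
  exact neg_le_neg (mul_le_mul_of_nonneg_right (hk n) ht)

/-- The response to a continuous scalar input along a fixed vector lies in the domain. -/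
theorem exists_isDiagonalImage_integral {c : ℝ → ℝ} (hc : Continuous c) (h : E) {t : ℝ}
    (ht : 0 ≤ t) :
    ∃ g, IsDiagonalImage b lam
      (∫ s in (0 : ℝ)..t, c s • diagonalSemigroup b hlam (max (t - s) 0) h) g := by
  rw [exists_isDiagonalImage_iff]
  obtain ⟨K, hK⟩ := (isCompact_Icc (a := (0 : ℝ)) (b := t)).exists_bound_of_continuousOn
    hc.continuousOn
  have hSh : Continuous fun s : ℝ => diagonalSemigroup b hlam (max (t - s) 0) h :=
    (isC0Semigroup_diagonalSemigroup b hlam).continuous_uncurry.comp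
      ((continuous_const.sub continuous_id).prodMk continuous_const)
  have hcoord : ∀ n, inner ℝ (b n)
      (∫ s in (0 : ℝ)..t, c s • diagonalSemigroup b hlam (max (t - s) 0) h) =
      (∫ s in (0 : ℝ)..t, c s * Real.exp (-(lam n * (t - s)))) * inner ℝ (b n) h := by
    intro n
    have h1 := (innerSL ℝ (b n)).intervalIntegral_comp_comm
      ((hc.smul hSh).intervalIntegrable (μ := volume) 0 t)
    simp only [innerSL_apply_apply, Pi.smul_apply'] at h1
    rw [← h1, ← intervalIntegral.integral_mul_const]
    refine intervalIntegral.integral_congr fun s hs => ?_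
    rw [uIcc_of_le ht] at hs
    simp only [inner_smul_right, inner_diagonalSemigroup]
    rw [max_eq_left (le_max_right _ _), max_eq_left (sub_nonneg.2 hs.2), mul_assoc]
  have hd : ∀ n, |lam n * ∫ s in (0 : ℝ)..t, c s * Real.exp (-(lam n * (t - s)))| ≤ K := by
    intro n
    have h1 : |∫ s in (0 : ℝ)..t, c s * Real.exp (-(lam n * (t - s)))| ≤
        ∫ s in (0 : ℝ)..t, K * Real.exp (-(lam n * (t - s))) := by
      rw [← Real.norm_eq_abs]
      refine intervalIntegral.norm_integral_le_of_norm_le ht ?_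
        (Continuous.intervalIntegrable (by fun_prop) _ _)
      refine Eventually.of_forall fun s hs => ?_
      rw [norm_mul, Real.norm_eq_abs (Real.exp _), Real.abs_exp]
      exact mul_le_mul_of_nonneg_right (hK s ⟨hs.1.le, hs.2⟩) (Real.exp_pos _).le
    have h2 : lam n * ∫ s in (0 : ℝ)..t, K * Real.exp (-(lam n * (t - s))) =
        K * (1 - Real.exp (-(lam n * t))) := by
      rw [← intervalIntegral.integral_const_mul]
      have := intervalIntegral.integral_eq_sub_of_hasDerivAt (a := 0) (b := t)
        (f := fun s => K * Real.exp (-(lam n * (t - s))))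
        (f' := fun s => lam n * (K * Real.exp (-(lam n * (t - s))))) (fun s _ => ?_)
        (Continuous.intervalIntegrable (by fun_prop) _ _)
      · rw [this]; simp; ring
      · have h3 : HasDerivAt (fun s => -(lam n * (t - s))) (lam n) s := by
          simpa using ((hasDerivAt_id s).const_sub t).const_mul (-lam n)
        have h4 := h3.exp.const_mul K
        exact h4.congr_deriv (by ring)
    rw [abs_mul, abs_of_nonneg (hlam n)]
    refine (mul_le_mul_of_nonneg_left h1 (hlam n)).trans ?_
    rw [h2]
    have hK0 : 0 ≤ K := (norm_nonneg _).trans (hK 0 ⟨le_rfl, ht⟩)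
    nlinarith [Real.exp_pos (-(lam n * t))]
  refine (summable_mul_inner_sq b hd h).congr fun n => ?_
  rw [hcoord, mul_assoc]

end Diagonal

section


/-! ### Square integrable functions and weak derivatives -/

variable {U : Set (ℝ × ℝ)}

theorem inner_L2_eq (u v : L2 U) : inner ℝ u v = ∫ p in U, u p * v p := by
  rw [L2.inner_def]
  refine integral_congr_ae (Eventually.of_forall fun p => ?_)
  simp [mul_comm]

theorem inner_toLp_eq (u : L2 U) {ψ : ℝ × ℝ → ℝ} (hψ : MemLp ψ 2 (volume.restrict U)) :
    inner ℝ (hψ.toLp ψ) u = ∫ p in U, u p * ψ p := by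
  rw [inner_L2_eq]
  refine integral_congr_ae ?_
  filter_upwards [hψ.coeFn_toLp] with p hp
  rw [hp, mul_comm]

theorem norm_sq_L2_eq (u : L2 U) : ‖u‖ ^ 2 = ∫ p in U, u p ^ 2 := by
  rw [← real_inner_self_eq_norm_sq, inner_L2_eq]
  simp only [sq]

/-- Bounded convergence in `L²`. -/
theorem tendsto_L2_of_bounded (hU : volume U ≠ ⊤) {F : ℕ → L2 U} {G : L2 U} (K : ℝ)
    (hK : ∀ N, ∀ᵐ p ∂(volume.restrict U), |F N p - G p| ≤ K)
    (hlim : ∀ᵐ p ∂(volume.restrict U), Tendsto (fun N => F N p) atTop (𝓝 (G p))) :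
    Tendsto F atTop (𝓝 G) := by
  have : IsFiniteMeasure ((volume : Measure (ℝ × ℝ)).restrict U) := isFiniteMeasure_restrict.2 hU
  rw [tendsto_iff_norm_sub_tendsto_zero]
  have h1 : Tendsto (fun N => ∫ p in U, (F N - G : L2 U) p ^ 2) atTop (𝓝 (∫ _ in U, (0 : ℝ))) := by
    refine tendsto_integral_of_dominated_convergence (fun _ => K ^ 2)
      (fun N => (Lp.aestronglyMeasurable _).pow 2) (integrable_const _) (fun N => ?_) ?_
    · filter_upwards [hK N, Lp.coeFn_sub (F N) G] with p hp hq
      rw [hq, Pi.sub_apply, norm_pow, Real.norm_eq_abs]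
      exact pow_le_pow_left₀ (abs_nonneg _) hp 2
    · filter_upwards [hlim, ae_all_iff.2 fun N => Lp.coeFn_sub (F N) G] with p hp hq
      have := (hp.sub_const (G p)).pow 2
      simp only [sub_self, ne_eq, OfNat.ofNat_ne_zero, not_false_eq_true, zero_pow] at this
      refine this.congr fun N => ?_
      rw [hq N, Pi.sub_apply]
  simp only [← norm_sq_L2_eq, integral_zero] at h1
  have h2 := h1.sqrt
  simpa [Real.sqrt_sq (norm_nonneg _)] using h2

theorem HasWeakPartialDeriv.congr {k : Fin 2} {u g u' g' : ℝ × ℝ → ℝ}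
    (h : HasWeakPartialDeriv U k u g) (hu : u =ᵐ[volume.restrict U] u')
    (hg : g =ᵐ[volume.restrict U] g') : HasWeakPartialDeriv U k u' g' := by
  intro φ hφ
  have h1 : ∫ p in U, u' p * partialDeriv k φ p = ∫ p in U, u p * partialDeriv k φ p :=
    integral_congr_ae (hu.mono fun p hp => by simp only [hp])
  have h2 : ∫ p in U, g' p * φ p = ∫ p in U, g p * φ p :=
    integral_congr_ae (hg.mono fun p hp => by simp only [hp])
  rw [h1, h2, h φ hφ]

theorem tsupport_partialDeriv_subset (k : Fin 2) (φ : ℝ × ℝ → ℝ) :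
    tsupport (partialDeriv k φ) ⊆ tsupport φ :=
  tsupport_fderiv_apply_subset ℝ _

theorem IsTestFunction.mono {V : Set (ℝ × ℝ)} {φ : ℝ × ℝ → ℝ} (h : IsTestFunction U φ)
    (hUV : U ⊆ V) : IsTestFunction V φ :=
  ⟨h.1, h.2.1, h.2.2.trans hUV⟩

theorem setIntegral_mul_eq_of_tsupport_subset {V : Set (ℝ × ℝ)} (hUV : U ⊆ V) (u : ℝ × ℝ → ℝ)
    {ψ : ℝ × ℝ → ℝ} (hψ : tsupport ψ ⊆ U) (hV : MeasurableSet V) :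
    ∫ p in U, u p * ψ p = ∫ p in V, u p * ψ p := by
  refine (setIntegral_eq_of_subset_of_forall_sdiff_eq_zero hV hUV fun p hp => ?_).symm
  rw [image_eq_zero_of_notMem_tsupport fun h => hp.2 (hψ h), mul_zero]

theorem HasWeakPartialDeriv.mono {V : Set (ℝ × ℝ)} (hV : MeasurableSet V) (hUV : U ⊆ V)
    {k : Fin 2} {u g : ℝ × ℝ → ℝ} (h : HasWeakPartialDeriv V k u g) :
    HasWeakPartialDeriv U k u g := by
  intro φ hφ
  rw [setIntegral_mul_eq_of_tsupport_subset hUV u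
      ((tsupport_partialDeriv_subset k φ).trans hφ.2.2) hV,
    setIntegral_mul_eq_of_tsupport_subset hUV g hφ.2.2 hV]
  exact h φ (hφ.mono hUV)

theorem continuous_partialDeriv {F : ℝ × ℝ → ℝ} (hF : ContDiff ℝ 1 F) (k : Fin 2) :
    Continuous (partialDeriv k F) :=
  (hF.continuous_fderiv (by simp)).clm_apply continuous_const

/-- A classical partial derivative is a weak partial derivative. -/
theorem hasWeakPartialDeriv_partialDeriv {F : ℝ × ℝ → ℝ} (hF : ContDiff ℝ 1 F) (k : Fin 2) :
    HasWeakPartialDeriv U k F (partialDeriv k F) := by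
  intro φ hφ
  have hφ1 : ContDiff ℝ 1 φ := hφ.1.of_le (by exact_mod_cast le_top)
  have hU : ∀ (u : ℝ × ℝ → ℝ) {ψ : ℝ × ℝ → ℝ}, tsupport ψ ⊆ U →
      ∫ p in U, u p * ψ p = ∫ p, u p * ψ p := fun u ψ hψ => by
    rw [setIntegral_mul_eq_of_tsupport_subset (subset_univ U) u hψ MeasurableSet.univ,
      Measure.restrict_univ]
  rw [hU F ((tsupport_partialDeriv_subset k φ).trans hφ.2.2), hU _ hφ.2.2]
  have hint : ∀ {u ψ : ℝ × ℝ → ℝ}, Continuous u → Continuous ψ → HasCompactSupport ψ →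
      Integrable (fun p => u p * ψ p) := fun hu hψ hs =>
    (hu.mul hψ).integrable_of_hasCompactSupport hs.mul_left
  -- On the whole plane there is no boundary term, since the test function has compact support.
  exact integral_mul_fderiv_eq_neg_fderiv_mul_of_integrable
    (hint (continuous_partialDeriv hF k) hφ.1.continuous hφ.2.1)
    (hint hF.continuous (continuous_partialDeriv hφ1 k) (hφ.2.1.fderiv_apply (𝕜 := ℝ) _))
    (hint hF.continuous hφ.1.continuous hφ.2.1)
    (fun p _ => hF.differentiable (by simp) p) (fun p _ => hφ1.differentiable (by simp) p)

/-- As identities between inner products, the defining relations are visibly stable under `L²`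
limits, which justifies termwise differentiation of series. -/
theorem hasWeakPartialDeriv_L2_iff {k : Fin 2} {u g : L2 U} :
    HasWeakPartialDeriv U k u g ↔ ∀ (φ : ℝ × ℝ → ℝ) (hφ : IsTestFunction U φ),
      inner ℝ ((hφ.memLp_partialDeriv k).toLp _) u = - inner ℝ (hφ.memLp.toLp _) g := by
  refine forall_congr' fun φ => forall_congr' fun hφ => ?_
  rw [inner_toLp_eq, inner_toLp_eq]

theorem HasWeakPartialDeriv.of_hasSum {ι : Type*} {k : Fin 2} {u g : ι → L2 U} {su sg : L2 U}
    (h : ∀ n, HasWeakPartialDeriv U k (u n) (g n)) (hu : HasSum u su) (hg : HasSum g sg) :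
    HasWeakPartialDeriv U k su sg := by
  rw [hasWeakPartialDeriv_L2_iff]
  intro φ hφ
  have h1 := hu.mapL (innerSL ℝ ((hφ.memLp_partialDeriv k).toLp _))
  have h2 := (hg.mapL (innerSL ℝ (hφ.memLp.toLp _))).neg
  simp only [innerSL_apply_apply] at h1 h2
  refine h1.unique (h2.congr_fun fun n => ?_)
  exact hasWeakPartialDeriv_L2_iff.1 (h n) φ hφ

/-! ### The space `H₀¹` -/

theorem partialDeriv_add {φ ψ : ℝ × ℝ → ℝ} (hφ : Differentiable ℝ φ) (hψ : Differentiable ℝ ψ)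
    (k : Fin 2) : partialDeriv k (φ + ψ) = partialDeriv k φ + partialDeriv k ψ := by
  ext p
  simp only [partialDeriv, fderiv_add (hφ p) (hψ p), Pi.add_apply, add_apply]

theorem partialDeriv_const_smul (c : ℝ) {φ : ℝ × ℝ → ℝ} (hφ : Differentiable ℝ φ)
    (k : Fin 2) : partialDeriv k (c • φ) = c • partialDeriv k φ := by
  ext p
  simp only [partialDeriv, fderiv_const_smul (hφ p) c, Pi.smul_apply,
    smul_apply]

theorem IsTestFunction.differentiable {φ : ℝ × ℝ → ℝ} (h : IsTestFunction U φ) :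
    Differentiable ℝ φ :=
  h.1.differentiable (by simp)

theorem IsTestFunction.zero (U : Set (ℝ × ℝ)) : IsTestFunction U 0 :=
  ⟨contDiff_const, HasCompactSupport.zero, by simp [tsupport]⟩

theorem IsTestFunction.add {φ ψ : ℝ × ℝ → ℝ} (hφ : IsTestFunction U φ) (hψ : IsTestFunction U ψ) :
    IsTestFunction U (φ + ψ) :=
  ⟨hφ.1.add hψ.1, hφ.2.1.add hψ.2.1, (tsupport_add φ ψ).trans (union_subset hφ.2.2 hψ.2.2)⟩

theorem IsTestFunction.const_smul (c : ℝ) {φ : ℝ × ℝ → ℝ} (hφ : IsTestFunction U φ) :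
    IsTestFunction U (c • φ) :=
  ⟨contDiff_const.smul hφ.1, hφ.2.1.smul_left (f := fun _ => c),
    (tsupport_smul_subset_right (fun _ => c) φ).trans hφ.2.2⟩

/-- The jets of test functions. -/
def testJets (U : Set (ℝ × ℝ)) : Submodule ℝ (Jet U) where
  carrier := {w | ∃ φ : ℝ × ℝ → ℝ, IsTestFunction U φ ∧
    (w.fst : ℝ × ℝ → ℝ) =ᵐ[volume.restrict U] φ ∧
    ∀ k : Fin 2, (w.snd k : ℝ × ℝ → ℝ) =ᵐ[volume.restrict U] partialDeriv k φ}
  zero_mem' := by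
    refine ⟨0, IsTestFunction.zero U, Lp.coeFn_zero _ _ _, fun k => ?_⟩
    have : partialDeriv k 0 = 0 := by
      ext p
      change fderiv ℝ (fun _ => (0 : ℝ)) p _ = 0
      simp
    rw [this]
    exact Lp.coeFn_zero _ _ _
  add_mem' := by
    rintro w w' ⟨φ, h1, h2, h3⟩ ⟨ψ, h4, h5, h6⟩
    refine ⟨φ + ψ, h1.add h4, (Lp.coeFn_add _ _).trans (h2.add h5), fun k => ?_⟩
    rw [partialDeriv_add h1.differentiable h4.differentiable]
    exact (Lp.coeFn_add _ _).trans ((h3 k).add (h6 k))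
  smul_mem' := by
    rintro c w ⟨φ, h1, h2, h3⟩
    refine ⟨c • φ, h1.const_smul c, (Lp.coeFn_smul _ _).trans (h2.const_smul c), fun k => ?_⟩
    rw [partialDeriv_const_smul c h1.differentiable]
    exact (Lp.coeFn_smul _ _).trans ((h3 k).const_smul c)

theorem H10_eq (U : Set (ℝ × ℝ)) : H10 U = (testJets U).topologicalClosure := rfl

/-- The jet with components `u`, `g 0`, `g 1`. -/
def mkJet (u : L2 U) (g : Fin 2 → L2 U) : Jet U := WithLp.toLp 2 (u, WithLp.toLp 2 g)

theorem continuous_mkJet : Continuous fun x : L2 U × (Fin 2 → L2 U) => mkJet x.1 x.2 :=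
  (WithLp.prod_continuous_toLp 2 _ _).comp
    (continuous_fst.prodMk ((PiLp.continuous_toLp 2 _).comp continuous_snd))

theorem mkJet_mem_H10_of_hasSum {ι : Type*} {u : ι → L2 U} {g : ι → Fin 2 → L2 U}
    {su : L2 U} {sg : Fin 2 → L2 U} (h : ∀ n, mkJet (u n) (g n) ∈ H10 U)
    (hu : HasSum u su) (hg : ∀ k, HasSum (fun n => g n k) (sg k)) : mkJet su sg ∈ H10 U := by
  have h1 : HasSum (fun n => mkJet (u n) (g n)) (mkJet su sg) := by
    have h2 : HasSum g sg := Pi.hasSum.2 hg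
    have h3 := continuous_mkJet.tendsto (su, sg) |>.comp (hu.prodMk_nhds h2)
    refine h3.congr fun s => ?_
    induction s using Finset.cons_induction with
    | empty => rfl
    | cons a s ha ih =>
      simp only [Function.comp_apply, Finset.sum_cons] at ih ⊢
      rw [← ih]; rfl
  simp only [H10_eq, SetLike.mem_coe] at h ⊢
  exact (testJets U).isClosed_topologicalClosure.mem_of_tendsto h1
    (Eventually.of_forall fun s => Submodule.sum_mem _ fun n _ => h n)

/-! A smooth cutoff of the identity near zero. -/

/-- A smooth function vanishing on `[-1, 1]` and equal to the identity outside `[-2, 2]`. -/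
def cutoff (t : ℝ) : ℝ := t * Real.smoothTransition (t ^ 2 - 1)

theorem contDiff_cutoff : ContDiff ℝ ((⊤ : ℕ∞) : WithTop ℕ∞) cutoff :=
  contDiff_id.mul (Real.smoothTransition.contDiff.comp ((contDiff_id.pow 2).sub contDiff_const))

theorem cutoff_eq_zero {t : ℝ} (ht : |t| ≤ 1) : cutoff t = 0 := by
  rw [cutoff, Real.smoothTransition.zero_of_nonpos, mul_zero]
  have := (sq_le_one_iff_abs_le_one t).2 ht
  linarith

theorem cutoff_eq_self {t : ℝ} (ht : 2 ≤ |t|) : cutoff t = t := by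
  rw [cutoff, Real.smoothTransition.one_of_one_le, mul_one]
  have := sq_abs t
  nlinarith

theorem abs_cutoff_le (t : ℝ) : |cutoff t| ≤ |t| := by
  rw [cutoff, abs_mul, abs_of_nonneg (Real.smoothTransition.nonneg _)]
  exact mul_le_of_le_one_right (abs_nonneg _) (Real.smoothTransition.le_one _)

theorem deriv_cutoff_eq_one {t : ℝ} (ht : 2 < |t|) : deriv cutoff t = 1 := by
  have : cutoff =ᶠ[𝓝 t] id := by
    filter_upwards [continuous_abs.tendsto t |>.eventually (Ioi_mem_nhds ht)] with s hs
    exact cutoff_eq_self (mem_Ioi.1 hs).le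
  rw [this.deriv_eq, deriv_id]

theorem exists_abs_deriv_cutoff_le : ∃ K : ℝ, 1 ≤ K ∧ ∀ t, |deriv cutoff t| ≤ K := by
  obtain ⟨K, hK⟩ := (isCompact_Icc (a := (-2 : ℝ)) (b := 2)).exists_bound_of_continuousOn
    (contDiff_cutoff.continuous_deriv (by simp)).continuousOn
  refine ⟨max K 1, le_max_right _ _, fun t => ?_⟩
  by_cases ht : |t| ≤ 2
  · exact (hK t (abs_le.1 ht)).trans (le_max_left _ _)
  · rw [deriv_cutoff_eq_one (not_le.1 ht), abs_one]
    exact le_max_right _ _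

/-- A smooth function vanishing on the boundary of a bounded open set, with negligible zero set,
lies in `H₀¹`. -/
theorem mkJet_mem_H10 (hU : IsOpen U) (hb : Bornology.IsBounded U) {e : ℝ × ℝ → ℝ}
    (he : ContDiff ℝ ((⊤ : ℕ∞) : WithTop ℕ∞) e) (hfr : ∀ p ∈ frontier U, e p = 0)
    (hnull : ∀ᵐ p ∂(volume.restrict U), e p ≠ 0) {u : L2 U} {g : Fin 2 → L2 U}
    (hu : u =ᵐ[volume.restrict U] e) (hg : ∀ k, g k =ᵐ[volume.restrict U] partialDeriv k e) :
    mkJet u g ∈ H10 U := by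
  classical
  -- The approximants vanish where `|e| ≤ 1/(N+1)` and equal `e` where `|e| ≥ 2/(N+1)`; using `N +
  -- 1` avoids division by zero.
  set φ : ℕ → ℝ × ℝ → ℝ := fun N => U.indicator fun p => cutoff ((N + 1) * e p) / (N + 1) with hφ
  have hcl : IsCompact (closure U) := hb.isCompact_closure
  -- The lower bound on `|e|` survives in the closure, whereas `e` vanishes on the frontier; hence
  -- the support stays inside `U`.
  have hsub : ∀ N, tsupport (φ N) ⊆ {p | p ∈ closure U ∧ 1 ≤ |(N + 1) * e p|} := by
    intro N
    refine closure_minimal (fun p hp => ?_) (isClosed_closure.inter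
      (isClosed_le continuous_const (continuous_const.mul he.continuous).abs))
    have hpU : p ∈ U := by
      by_contra h
      exact hp (indicator_of_notMem h _)
    refine ⟨subset_closure hpU, ?_⟩
    by_contra h
    refine hp ?_
    simp only [hφ, indicator_of_mem hpU]
    rw [cutoff_eq_zero (not_le.1 h).le, zero_div]
  have htest : ∀ N, IsTestFunction U (φ N) := by
    intro N
    have htU : tsupport (φ N) ⊆ U := by
      intro p hp
      obtain ⟨h1, h2⟩ := hsub N hp
      by_contra h
      have : p ∈ frontier U := ⟨h1, by rwa [hU.interior_eq]⟩
      rw [hfr p this, mul_zero, abs_zero] at h2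
      linarith
    refine ⟨contDiff_iff_contDiffAt.2 fun p => ?_, ?_, htU⟩
    · by_cases hp : p ∈ U
      · have h1 : ContDiff ℝ ((⊤ : ℕ∞) : WithTop ℕ∞) fun p => cutoff ((N + 1) * e p) / (N + 1) :=
          (contDiff_cutoff.comp (contDiff_const.mul he)).div_const _
        refine h1.contDiffAt.congr_of_eventuallyEq ?_
        filter_upwards [hU.mem_nhds hp] with q hq
        exact indicator_of_mem hq _
      · have : φ N =ᶠ[𝓝 p] fun _ => 0 :=
          notMem_tsupport_iff_eventuallyEq.1 fun h => hp (htU h)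
        exact contDiffAt_const.congr_of_eventuallyEq this
    · exact hcl.of_isClosed_subset (isClosed_tsupport _) fun p hp => (hsub N hp).1
  obtain ⟨K, hK1, hK⟩ := exists_abs_deriv_cutoff_le
  have hvol : volume U ≠ ⊤ := (hb.measure_lt_top).ne
  have hmem : ∀ᵐ p ∂(volume.restrict U), p ∈ U := ae_restrict_mem hU.measurableSet
  have hbd : ∀ {ψ : ℝ × ℝ → ℝ}, Continuous ψ → ∃ C, ∀ p ∈ U, |ψ p| ≤ C := fun hψ => by
    obtain ⟨C, hC⟩ := hcl.exists_bound_of_continuousOn hψ.continuousOn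
    exact ⟨C, fun p hp => hC p (subset_closure hp)⟩
  have hN0 : ∀ N : ℕ, (0 : ℝ) < N + 1 := fun N => by positivity
  have hlarge : ∀ p, e p ≠ 0 → ∀ᶠ N : ℕ in atTop, 2 < |((N : ℝ) + 1) * e p| := by
    intro p hp
    have h1 : Tendsto (fun N : ℕ => ((N : ℝ) + 1) * |e p|) atTop atTop :=
      (tendsto_atTop_add_const_right _ _ tendsto_natCast_atTop_atTop).atTop_mul_const
        (abs_pos.2 hp)
    filter_upwards [h1.eventually_gt_atTop 2] with N hN
    rwa [abs_mul, abs_of_pos (hN0 N)]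
  -- The factors `N + 1` cancel in the chain rule, so the gradients are bounded uniformly in `N` and
  -- eventually equal that of `e` off its null zero set. Bounded convergence then applies.
  have hpd : ∀ N, ∀ p ∈ U, ∀ k, partialDeriv k (φ N) p =
      deriv cutoff ((N + 1) * e p) * partialDeriv k e p := by
    intro N p hp k
    have h1 : φ N =ᶠ[𝓝 p] fun p => cutoff ((N + 1) * e p) / (N + 1) := by
      filter_upwards [hU.mem_nhds hp] with q hq
      exact indicator_of_mem hq _
    have h2 : HasFDerivAt e (fderiv ℝ e p) p := (he.differentiable (by simp) p).hasFDerivAt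
    have h3 : HasDerivAt cutoff (deriv cutoff ((N + 1) * e p)) ((N + 1) * e p) :=
      (contDiff_cutoff.differentiable (by simp) _).hasDerivAt
    have h4 := (h3.comp_hasFDerivAt p (h2.const_mul ((N : ℝ) + 1))).mul_const ((N : ℝ) + 1)⁻¹
    have h5 : HasFDerivAt (fun p => cutoff ((N + 1) * e p) / (N + 1)) _ p := h4
    rw [partialDeriv, h1.fderiv_eq, h5.fderiv]
    simp only [smul_apply, smul_eq_mul, partialDeriv]
    have := (hN0 N).ne'
    field_simp
  have hfst : Tendsto (fun N => (htest N).memLp.toLp (φ N)) atTop (𝓝 u) := by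
    obtain ⟨C, hC⟩ := hbd he.continuous
    refine tendsto_L2_of_bounded hvol (2 * C) (fun N => ?_) ?_
    · filter_upwards [(htest N).memLp.coeFn_toLp, hu, hmem] with p h1 h2 hp
      rw [h1, h2, hφ]
      simp only [indicator_of_mem hp]
      refine (abs_sub _ _).trans ?_
      have h3 : |cutoff ((N + 1) * e p) / (N + 1)| ≤ |e p| := by
        rw [abs_div, abs_of_pos (hN0 N), div_le_iff₀ (hN0 N)]
        refine (abs_cutoff_le _).trans ?_
        rw [abs_mul, abs_of_pos (hN0 N), mul_comm]
      linarith [hC p hp]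
    · filter_upwards [ae_all_iff.2 fun N => (htest N).memLp.coeFn_toLp, hu, hmem, hnull]
        with p h1 h2 hp h0
      rw [h2]
      refine tendsto_const_nhds.congr' ?_
      filter_upwards [hlarge p h0] with N hN
      rw [h1 N, hφ]
      simp only [indicator_of_mem hp]
      rw [cutoff_eq_self hN.le, mul_div_cancel_left₀ _ (hN0 N).ne']
  have hsnd : ∀ k, Tendsto (fun N => ((htest N).memLp_partialDeriv k).toLp _) atTop (𝓝 (g k)) := by
    intro k
    obtain ⟨C, hC⟩ := hbd (continuous_partialDeriv (he.of_le (by exact_mod_cast le_top)) k)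
    refine tendsto_L2_of_bounded hvol (K * C + C) (fun N => ?_) ?_
    · filter_upwards [((htest N).memLp_partialDeriv k).coeFn_toLp, hg k, hmem] with p h1 h2 hp
      rw [h1, h2, hpd N p hp]
      refine (abs_sub _ _).trans (add_le_add ?_ (hC p hp))
      rw [abs_mul]
      exact mul_le_mul (hK _) (hC p hp) (abs_nonneg _) (by linarith)
    · filter_upwards [ae_all_iff.2 fun N => ((htest N).memLp_partialDeriv k).coeFn_toLp, hg k,
        hmem, hnull] with p h1 h2 hp h0
      rw [h2]
      refine tendsto_const_nhds.congr' ?_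
      filter_upwards [hlarge p h0] with N hN
      rw [h1 N, hpd N p hp, deriv_cutoff_eq_one hN, one_mul]
  have hjet := (continuous_mkJet.tendsto (u, g)).comp
    (hfst.prodMk_nhds (tendsto_pi_nhds.2 hsnd))
  refine mem_closure_of_tendsto hjet (Eventually.of_forall fun N => ?_)
  exact ⟨φ N, htest N, (htest N).memLp.coeFn_toLp,
    fun k => ((htest N).memLp_partialDeriv k).coeFn_toLp⟩

end

section


/-! ### Trigonometric systems on a rectangle -/

/-- `cos` for `true`, `sin` for `false`. -/
def trig (s : Bool) (x : ℝ) : ℝ := cond s (Real.cos x) (Real.sin x)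

/-- The sign in the derivative of `trig s`. -/
def trigSign (s : Bool) : ℝ := cond s (-1) 1

theorem abs_trigSign (s : Bool) : |trigSign s| = 1 := by cases s <;> simp [trigSign]

theorem hasDerivAt_trig (s : Bool) (x : ℝ) :
    HasDerivAt (trig s) (trigSign s * trig (!s) x) x := by
  cases s
  · exact (Real.hasDerivAt_sin x).congr_deriv (by simp [trigSign, trig])
  · exact (Real.hasDerivAt_cos x).congr_deriv (by simp [trigSign, trig])

theorem contDiff_trig (s : Bool) : ContDiff ℝ ((⊤ : ℕ∞) : WithTop ℕ∞) (trig s) := by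
  cases s
  · exact Real.contDiff_sin
  · exact Real.contDiff_cos

theorem trig_mul_trig (s : Bool) (x y : ℝ) :
    trig s x * trig s y = (Real.cos (x - y) - trigSign s * Real.cos (x + y)) / 2 := by
  cases s <;> simp only [trig, trigSign, cond_true, cond_false, Real.cos_sub, Real.cos_add] <;> ring

theorem integral_cos_int_mul_pi {a : ℝ} (ha : 0 < a) (k : ℤ) :
    ∫ x in (0 : ℝ)..a, Real.cos (k * (Real.pi / a) * x) = if k = 0 then a else 0 := by
  split_ifs with hk
  · simp [hk]
  · have hk' : (k : ℝ) * (Real.pi / a) ≠ 0 :=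
      mul_ne_zero (Int.cast_ne_zero.2 hk) (div_pos Real.pi_pos ha).ne'
    rw [intervalIntegral.integral_comp_mul_left (fun x => Real.cos x) hk', integral_cos,
      mul_assoc, div_mul_cancel₀ _ ha.ne', Real.sin_int_mul_pi]
    simp

theorem integral_trig_mul_trig {a : ℝ} (ha : 0 < a) (s : Bool) (i j : ℕ) :
    ∫ x in Ioo 0 a, trig s ((i + 1) * Real.pi / a * x) * trig s ((j + 1) * Real.pi / a * x) =
      if i = j then a / 2 else 0 := by
  rw [← integral_Ioc_eq_integral_Ioo, ← intervalIntegral.integral_of_le ha.le]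
  have h1 : ∀ x : ℝ, trig s ((i + 1) * Real.pi / a * x) * trig s ((j + 1) * Real.pi / a * x) =
      (Real.cos (((i - j : ℤ) : ℝ) * (Real.pi / a) * x) -
        trigSign s * Real.cos (((i + j + 2 : ℤ) : ℝ) * (Real.pi / a) * x)) * 2⁻¹ := by
    intro x
    rw [trig_mul_trig, div_eq_mul_inv]
    push_cast
    congr 3
    · ring
    · congr 2; ring
  simp only [h1]
  -- Index `i` stands for frequency `i + 1`, so the sum frequency `i + j + 2` never vanishes; this
  -- is why sines and cosines share the norm `a / 2`.
  rw [intervalIntegral.integral_mul_const, intervalIntegral.integral_sub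
    (Continuous.intervalIntegrable (by fun_prop) _ _)
    (Continuous.intervalIntegrable (by fun_prop) _ _), intervalIntegral.integral_const_mul,
    integral_cos_int_mul_pi ha, integral_cos_int_mul_pi ha,
    if_neg (by omega : (i + j + 2 : ℤ) ≠ 0)]
  by_cases h : i = j
  · simp [h, div_eq_mul_inv]
  · rw [if_neg h, if_neg (by omega)]; simp

/-- The open rectangle `]0, a 0[ × ]0, a 1[`. -/
def rect (a : Fin 2 → ℝ) : Set (ℝ × ℝ) := Ioo 0 (a 0) ×ˢ Ioo 0 (a 1)

theorem isOpen_rect (a : Fin 2 → ℝ) : IsOpen (rect a) := isOpen_Ioo.prod isOpen_Ioo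

theorem isBounded_rect (a : Fin 2 → ℝ) : Bornology.IsBounded (rect a) :=
  (Metric.isBounded_Ioo _ _).prod (Metric.isBounded_Ioo _ _)

theorem closure_rect_subset (a : Fin 2 → ℝ) :
    closure (rect a) ⊆ Icc 0 (a 0) ×ˢ Icc 0 (a 1) :=
  closure_minimal (prod_mono Ioo_subset_Icc_self Ioo_subset_Icc_self)
    (isClosed_Icc.prod isClosed_Icc)

theorem memLp_of_continuous_of_isBounded {U : Set (ℝ × ℝ)} (hU : MeasurableSet U)
    (hb : Bornology.IsBounded U) {ψ : ℝ × ℝ → ℝ} (hψ : Continuous ψ) :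
    MemLp ψ 2 (volume.restrict U) := by
  have : IsFiniteMeasure ((volume : Measure (ℝ × ℝ)).restrict U) :=
    isFiniteMeasure_restrict.2 hb.measure_lt_top.ne
  obtain ⟨C, hC⟩ := hb.isCompact_closure.exists_bound_of_continuousOn hψ.continuousOn
  refine MemLp.of_bound hψ.aestronglyMeasurable C ?_
  filter_upwards [ae_restrict_mem hU] with p hp using hC p (subset_closure hp)

variable (a : Fin 2 → ℝ)

/-- The frequency of the `n`-th mode in direction `k`. -/
def freq (k : Fin 2) (n : Fin 2 → ℕ) : ℝ := (n k + 1) * Real.pi / a k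

/-- The normalized product of trigonometric functions. -/
def trigProd (s : Fin 2 → Bool) (n : Fin 2 → ℕ) (p : ℝ × ℝ) : ℝ :=
  2 / √(a 0 * a 1) * (trig (s 0) (freq a 0 n * p.1) * trig (s 1) (freq a 1 n * p.2))

theorem contDiff_trigProd (s : Fin 2 → Bool) (n : Fin 2 → ℕ) :
    ContDiff ℝ ((⊤ : ℕ∞) : WithTop ℕ∞) (trigProd a s n) :=
  contDiff_const.mul (((contDiff_trig _).comp (contDiff_const.mul contDiff_fst)).mul
    ((contDiff_trig _).comp (contDiff_const.mul contDiff_snd)))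

/-- Interchange of sine and cosine in direction `k`. -/
def swapTrig (k : Fin 2) (s : Fin 2 → Bool) : Fin 2 → Bool := Function.update s k (!(s k))

theorem swapTrig_swapTrig (k : Fin 2) (s : Fin 2 → Bool) : swapTrig k (swapTrig k s) = s := by
  simp [swapTrig]

/-- Differentiation exchanges sine and cosine in one variable, so the mixed products form a family
closed under all derivatives up to scalars. -/
theorem partialDeriv_trigProd (k : Fin 2) (s : Fin 2 → Bool) (n : Fin 2 → ℕ) :
    partialDeriv k (trigProd a s n) =
      fun p => trigSign (s k) * freq a k n * trigProd a (swapTrig k s) n p := by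
  ext p
  have h0 : HasFDerivAt (fun p : ℝ × ℝ => freq a 0 n * p.1)
      (freq a 0 n • ContinuousLinearMap.fst ℝ ℝ ℝ) p := hasFDerivAt_fst.const_mul _
  have h1 : HasFDerivAt (fun p : ℝ × ℝ => freq a 1 n * p.2)
      (freq a 1 n • ContinuousLinearMap.snd ℝ ℝ ℝ) p := hasFDerivAt_snd.const_mul _
  have h2 := (((hasDerivAt_trig (s 0) _).comp_hasFDerivAt p h0).mul
    ((hasDerivAt_trig (s 1) _).comp_hasFDerivAt p h1)).const_mul (2 / √(a 0 * a 1))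
  have h3 : HasFDerivAt (trigProd a s n) _ p := h2
  rw [partialDeriv, h3.fderiv]
  fin_cases k <;>
    simp [trigProd, swapTrig] <;> ring

/-- `trigProd` as an element of `L²`. -/
def trigLp (s : Fin 2 → Bool) (n : Fin 2 → ℕ) : L2 (rect a) :=
  (memLp_of_continuous_of_isBounded (isOpen_rect a).measurableSet (isBounded_rect a)
    (contDiff_trigProd a s n).continuous).toLp (trigProd a s n)

theorem coeFn_trigLp (s : Fin 2 → Bool) (n : Fin 2 → ℕ) :
    trigLp a s n =ᵐ[volume.restrict (rect a)] trigProd a s n :=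
  MemLp.coeFn_toLp _

theorem partialDeriv_trigProd_ae_eq (k : Fin 2) (s : Fin 2 → Bool) (n : Fin 2 → ℕ) :
    ((trigSign (s k) * freq a k n) • trigLp a (swapTrig k s) n : L2 (rect a))
      =ᵐ[volume.restrict (rect a)] partialDeriv k (trigProd a s n) := by
  filter_upwards [Lp.coeFn_smul (trigSign (s k) * freq a k n) (trigLp a (swapTrig k s) n),
    coeFn_trigLp a (swapTrig k s) n] with p h1 h2
  rw [h1, Pi.smul_apply, h2, partialDeriv_trigProd, smul_eq_mul]

theorem hasWeakPartialDeriv_trigLp (k : Fin 2) (s : Fin 2 → Bool) (n : Fin 2 → ℕ) :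
    HasWeakPartialDeriv (rect a) k (trigLp a s n)
      ((trigSign (s k) * freq a k n) • trigLp a (swapTrig k s) n : L2 (rect a)) :=
  (hasWeakPartialDeriv_partialDeriv
    ((contDiff_trigProd a s n).of_le (by exact_mod_cast le_top)) k).congr
    (coeFn_trigLp a s n).symm (partialDeriv_trigProd_ae_eq a k s n).symm

variable {a}

theorem freq_pos (ha : ∀ k, 0 < a k) (k : Fin 2) (n : Fin 2 → ℕ) : 0 < freq a k n :=
  div_pos (mul_pos (by positivity) Real.pi_pos) (ha k)

theorem orthonormal_trigLp (ha : ∀ k, 0 < a k) (s : Fin 2 → Bool) : Orthonormal ℝ (trigLp a s) := by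
  rw [orthonormal_iff_ite]
  intro n m
  have h1 : inner ℝ (trigLp a s n) (trigLp a s m) =
      ∫ p in rect a, (4 / (a 0 * a 1)) *
        ((trig (s 0) (freq a 0 n * p.1) * trig (s 0) (freq a 0 m * p.1)) *
        (trig (s 1) (freq a 1 n * p.2) * trig (s 1) (freq a 1 m * p.2))) := by
    rw [inner_L2_eq]
    refine integral_congr_ae ?_
    filter_upwards [coeFn_trigLp a s n, coeFn_trigLp a s m] with p hn hm
    rw [hn, hm, trigProd, trigProd]
    have h4 : (2 / √(a 0 * a 1)) * (2 / √(a 0 * a 1)) = 4 / (a 0 * a 1) := by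
      rw [div_mul_div_comm, Real.mul_self_sqrt (mul_pos (ha 0) (ha 1)).le]; norm_num
    rw [← h4]; ring
  rw [h1, integral_const_mul, rect, Measure.volume_eq_prod,
    setIntegral_prod_mul (fun x => trig (s 0) (freq a 0 n * x) * trig (s 0) (freq a 0 m * x))
      (fun x => trig (s 1) (freq a 1 n * x) * trig (s 1) (freq a 1 m * x))]
  simp only [freq]
  rw [integral_trig_mul_trig (ha 0), integral_trig_mul_trig (ha 1)]
  have h0 := (ha 0).ne'
  have h1 := (ha 1).ne'
  by_cases h : n = m
  · subst h
    simp only [if_true]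
    field_simp; norm_num
  · rw [if_neg h]
    have : n 0 ≠ m 0 ∨ n 1 ≠ m 1 := by
      by_contra hc
      push Not at hc
      exact h (funext (Fin.forall_fin_two.2 hc))
    rcases this with h | h <;> simp [h]

/-! ### Completeness of the sine products. -/

theorem integrable_L2_mul {U : Set (ℝ × ℝ)} (hU : MeasurableSet U)
    (hb : Bornology.IsBounded U) (v : L2 U) {ψ : ℝ × ℝ → ℝ} (hψ : Continuous ψ) :
    Integrable (fun p => v p * ψ p) (volume.restrict U) :=
  (Lp.memLp v).integrable_mul (memLp_of_continuous_of_isBounded hU hb hψ)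

/-- The product `sin (i π ξ₁ / a₁) sin (j π ξ₂ / a₂)`, for integers `i` and `j`. -/
def sineProd (a : Fin 2 → ℝ) (i j : ℤ) (p : ℝ × ℝ) : ℝ :=
  Real.sin (i * (Real.pi / a 0 * p.1)) * Real.sin (j * (Real.pi / a 1 * p.2))

theorem continuous_sineProd (i j : ℤ) : Continuous (sineProd a i j) := by
  unfold sineProd; fun_prop

/-- `v P` is orthogonal to all products of sines. -/
def SineOrthogonal (v : L2 (rect a)) (P : ℝ × ℝ → ℝ) : Prop :=
  ∀ i j : ℤ, ∫ p in rect a, v p * (sineProd a i j p * P p) = 0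

/-- Sine is odd, so positive indices decide all integer ones. Integer indices keep the shifts `i ±
1` in `SineOrthogonal.mul_cos` within range. -/
theorem sineOrthogonal_one (ha : ∀ k, 0 < a k) {v : L2 (rect a)}
    (hv : ∀ n, inner ℝ (trigLp a (fun _ => false) n) v = 0) : SineOrthogonal v fun _ => 1 := by
  have hnat : ∀ i j : ℕ, ∫ p in rect a, v p * sineProd a (i + 1) (j + 1) p = 0 := by
    intro i j
    have h1 := hv ![i, j]
    rw [trigLp, inner_toLp_eq] at h1
    have h2 : ∀ p, v p * trigProd a (fun _ => false) ![i, j] p =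
        2 / √(a 0 * a 1) * (v p * sineProd a (i + 1) (j + 1) p) := by
      intro p
      simp only [trigProd, trig, cond_false, freq, Matrix.cons_val_zero, Matrix.cons_val_one,
        sineProd, Int.cast_add, Int.cast_natCast, Int.cast_one]
      rw [mul_left_comm]
      congr 4
      · ring_nf
      · ring_nf
    simp only [h2] at h1
    rw [integral_const_mul] at h1
    exact (mul_eq_zero.1 h1).resolve_left
      (div_pos two_pos (Real.sqrt_pos.2 (mul_pos (ha 0) (ha 1)))).ne'
  have hnegl : ∀ i j p, sineProd a (-i) j p = -sineProd a i j p := by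
    intro i j p; simp [sineProd]
  have hnegr : ∀ i j p, sineProd a i (-j) p = -sineProd a i j p := by
    intro i j p; simp [sineProd]
  have hcases : ∀ i : ℤ, i = 0 ∨ ∃ n : ℕ, i = n + 1 ∨ i = -(n + 1) := by
    intro i
    rcases lt_trichotomy i 0 with h | h | h
    · exact Or.inr ⟨(-i - 1).toNat, Or.inr (by omega)⟩
    · exact Or.inl h
    · exact Or.inr ⟨(i - 1).toNat, Or.inl (by omega)⟩
  intro i j
  simp only [mul_one]
  rcases hcases i with rfl | ⟨n, hn⟩
  · simp [sineProd]
  rcases hcases j with rfl | ⟨m, hm⟩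
  · simp [sineProd]
  have := hnat n m
  rcases hn with rfl | rfl <;> rcases hm with rfl | rfl <;>
    simp only [hnegl, hnegr, mul_neg, neg_neg, integral_neg, this, neg_zero]

/-- Product to sum: `2 sin(ix) cos x = sin((i+1)x) + sin((i-1)x)`. -/
theorem SineOrthogonal.mul_cos {v : L2 (rect a)} {P : ℝ × ℝ → ℝ} (hP : Continuous P)
    (h : SineOrthogonal v P) :
    (SineOrthogonal v fun p => Real.cos (Real.pi / a 0 * p.1) * P p) ∧
    SineOrthogonal v fun p => Real.cos (Real.pi / a 1 * p.2) * P p := by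
  have hint : ∀ i j, Integrable (fun p => v p * (sineProd a i j p * P p))
      (volume.restrict (rect a)) := fun i j =>
    integrable_L2_mul (isOpen_rect a).measurableSet (isBounded_rect a) v
      ((continuous_sineProd i j).mul hP)
  have hsc : ∀ (i : ℤ) (x : ℝ), Real.sin (i * x) * Real.cos x =
      (Real.sin ((i + 1 : ℤ) * x) + Real.sin ((i - 1 : ℤ) * x)) / 2 := by
    intro i x
    push_cast
    rw [add_mul, sub_mul, one_mul, Real.sin_add, Real.sin_sub]; ring
  constructor <;> intro i j
  · have : ∀ p, v p * (sineProd a i j p * (Real.cos (Real.pi / a 0 * p.1) * P p)) =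
        (v p * (sineProd a (i + 1) j p * P p) + v p * (sineProd a (i - 1) j p * P p)) * 2⁻¹ := by
      intro p
      have := hsc i (Real.pi / a 0 * p.1)
      simp only [sineProd]
      linear_combination (v p * Real.sin (j * (Real.pi / a 1 * p.2)) * P p) * this
    simp only [this]
    rw [integral_mul_const, integral_add (hint _ _) (hint _ _), h, h]
    simp
  · have : ∀ p, v p * (sineProd a i j p * (Real.cos (Real.pi / a 1 * p.2) * P p)) =
        (v p * (sineProd a i (j + 1) p * P p) + v p * (sineProd a i (j - 1) p * P p)) * 2⁻¹ := by
      intro p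
      have := hsc j (Real.pi / a 1 * p.2)
      simp only [sineProd]
      linear_combination (v p * Real.sin (i * (Real.pi / a 0 * p.1)) * P p) * this
    simp only [this]
    rw [integral_mul_const, integral_add (hint _ _) (hint _ _), h, h]
    simp

/-- Polynomials in `cos (π ξ₁ / a₁)` and `cos (π ξ₂ / a₂)` are dense in the continuous functions on
the closed rectangle. -/
theorem exists_approx_sineOrthogonal (ha : ∀ k, 0 < a k) {v : L2 (rect a)}
    (hv : SineOrthogonal v fun _ => 1) {f : ℝ × ℝ → ℝ} (hf : Continuous f) {ε : ℝ} (hε : 0 < ε) :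
    ∃ P : ℝ × ℝ → ℝ, Continuous P ∧ SineOrthogonal v P ∧ ∀ p ∈ rect a, |f p - P p| ≤ ε := by
  set K : Set (ℝ × ℝ) := Icc 0 (a 0) ×ˢ Icc 0 (a 1) with hK
  have : CompactSpace K := isCompact_iff_compactSpace.1 (isCompact_Icc.prod isCompact_Icc)
  set c₁ : C(K, ℝ) := ⟨fun p => Real.cos (Real.pi / a 0 * p.1.1), by fun_prop⟩ with hc₁
  set c₂ : C(K, ℝ) := ⟨fun p => Real.cos (Real.pi / a 1 * p.1.2), by fun_prop⟩ with hc₂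
  set A : Subalgebra ℝ C(K, ℝ) := Algebra.adjoin ℝ {c₁, c₂} with hA
  -- Injectivity of cosine on `[0, π]` makes the two generators separate points, as
  -- Stone–Weierstrass demands.
  have hinj : ∀ k, ∀ x ∈ Icc 0 (a k), ∀ y ∈ Icc 0 (a k),
      Real.cos (Real.pi / a k * x) = Real.cos (Real.pi / a k * y) → x = y := by
    intro k x hx y hy hxy
    have hpos : 0 < Real.pi / a k := div_pos Real.pi_pos (ha k)
    have hmem : ∀ z ∈ Icc 0 (a k), Real.pi / a k * z ∈ Icc 0 Real.pi := fun z hz =>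
      ⟨mul_nonneg hpos.le hz.1, by
        calc Real.pi / a k * z ≤ Real.pi / a k * a k := mul_le_mul_of_nonneg_left hz.2 hpos.le
          _ = Real.pi := div_mul_cancel₀ _ (ha k).ne'⟩
    exact mul_left_cancel₀ hpos.ne' (Real.injOn_cos (hmem x hx) (hmem y hy) hxy)
  have hsep : A.SeparatesPoints := by
    intro x y hxy
    by_cases h1 : x.1.1 = y.1.1
    · have h2 : x.1.2 ≠ y.1.2 := fun h2 => hxy (Subtype.ext (Prod.ext h1 h2))
      exact ⟨c₂, ⟨c₂, Algebra.subset_adjoin (by simp), rfl⟩,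
        fun h => h2 (hinj 1 _ x.2.2 _ y.2.2 h)⟩
    · exact ⟨c₁, ⟨c₁, Algebra.subset_adjoin (by simp), rfl⟩,
        fun h => h1 (hinj 0 _ x.2.1 _ y.2.1 h)⟩
  -- Quantifying over a further factor `Q` lets the product case apply the two induction hypotheses
  -- one after the other.
  have hrep : ∀ g ∈ A, ∃ P : ℝ × ℝ → ℝ, Continuous P ∧ (∀ x : K, P x = g x) ∧
      ∀ Q : ℝ × ℝ → ℝ, Continuous Q → SineOrthogonal v Q →
        SineOrthogonal v fun p => P p * Q p := by
    intro g hg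
    induction hg using Algebra.adjoin_induction with
    | mem x hx =>
      rcases hx with rfl | rfl
      · exact ⟨fun p => Real.cos (Real.pi / a 0 * p.1), by fun_prop, fun _ => rfl,
          fun Q hQ h => (h.mul_cos hQ).1⟩
      · exact ⟨fun p => Real.cos (Real.pi / a 1 * p.2), by fun_prop, fun _ => rfl,
          fun Q hQ h => (h.mul_cos hQ).2⟩
    | algebraMap r =>
      refine ⟨fun _ => r, continuous_const, fun _ => rfl, fun Q hQ h i j => ?_⟩
      have : ∀ p, v p * (sineProd a i j p * (r * Q p)) = r * (v p * (sineProd a i j p * Q p)) :=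
        fun p => by ring
      simp only [this]
      rw [integral_const_mul, h i j, mul_zero]
    | add x y _ _ ihx ihy =>
      obtain ⟨P, hP, hPx, hPZ⟩ := ihx
      obtain ⟨P', hP', hPx', hPZ'⟩ := ihy
      refine ⟨fun p => P p + P' p, hP.add hP', fun z => by simp [hPx, hPx'],
        fun Q hQ h i j => ?_⟩
      have : ∀ p, v p * (sineProd a i j p * ((P p + P' p) * Q p)) =
          v p * (sineProd a i j p * (P p * Q p)) + v p * (sineProd a i j p * (P' p * Q p)) :=
        fun p => by ring
      have hint : ∀ {R : ℝ × ℝ → ℝ}, Continuous R →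
          Integrable (fun p => v p * (sineProd a i j p * (R p * Q p)))
            (volume.restrict (rect a)) := fun hR =>
        integrable_L2_mul (isOpen_rect a).measurableSet (isBounded_rect a) v
          ((continuous_sineProd i j).mul (hR.mul hQ))
      simp only [this]
      rw [integral_add (hint hP) (hint hP'), hPZ Q hQ h i j, hPZ' Q hQ h i j, add_zero]
    | mul x y _ _ ihx ihy =>
      obtain ⟨P, hP, hPx, hPZ⟩ := ihx
      obtain ⟨P', hP', hPx', hPZ'⟩ := ihy
      refine ⟨fun p => P p * P' p, hP.mul hP', fun z => by simp [hPx, hPx'],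
        fun Q hQ h => ?_⟩
      have := hPZ (fun p => P' p * Q p) (hP'.mul hQ) (hPZ' Q hQ h)
      simpa only [mul_assoc] using this
  obtain ⟨g, hg⟩ := ContinuousMap.exists_mem_subalgebra_near_continuousMap_of_separatesPoints A hsep
    ⟨fun x : K => f x, by fun_prop⟩ ε hε
  obtain ⟨P, hP, hPg, hPZ⟩ := hrep g g.2
  refine ⟨P, hP, ?_, fun p hp => ?_⟩
  · simpa using hPZ (fun _ => 1) continuous_const hv
  · have hpK : p ∈ K := closure_rect_subset a (subset_closure hp)
    have h1 := (ContinuousMap.norm_coe_le_norm _ (⟨p, hpK⟩ : K)).trans hg.le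
    rw [hPg ⟨p, hpK⟩, abs_sub_comm]
    exact h1

/-- With the first sine product as weight, `v` is orthogonal to all polynomials in the two cosines,
hence to all continuous functions. So the weighted function vanishes a.e., and the weight is
positive inside the rectangle. -/
theorem eq_zero_of_inner_sine_eq_zero (ha : ∀ k, 0 < a k) {v : L2 (rect a)}
    (hv : ∀ n, inner ℝ (trigLp a (fun _ => false) n) v = 0) : v = 0 := by
  have hmeas := (isOpen_rect a).measurableSet
  set w : ℝ × ℝ → ℝ := fun p => v p * sineProd a 1 1 p with hw
  have hwint : Integrable w (volume.restrict (rect a)) :=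
    integrable_L2_mul hmeas (isBounded_rect a) v (continuous_sineProd 1 1)
  have hzero : ∀ f : ℝ × ℝ → ℝ, Continuous f → ∫ p in rect a, w p * f p = 0 := by
    intro f hf
    have hb : ∀ ε : ℝ, 0 < ε → |∫ p in rect a, w p * f p| ≤ ε * ∫ p in rect a, |w p| := by
      intro ε hε
      obtain ⟨P, hP, hPZ, hPf⟩ := exists_approx_sineOrthogonal ha (sineOrthogonal_one ha hv) hf hε
      have hint : ∀ {ψ : ℝ × ℝ → ℝ}, Continuous ψ → Integrable (fun p => w p * ψ p)
          (volume.restrict (rect a)) := fun hψ => by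
        simpa only [hw, mul_assoc, Pi.mul_apply] using integrable_L2_mul hmeas (isBounded_rect a) v
          ((continuous_sineProd 1 1).mul hψ)
      have h1 : ∫ p in rect a, w p * P p = 0 := by
        simpa only [hw, mul_assoc] using hPZ 1 1
      have h2 : ∫ p in rect a, w p * f p = ∫ p in rect a, w p * (f p - P p) := by
        simp only [mul_sub]
        rw [integral_sub (hint hf) (hint hP), h1, sub_zero]
      rw [h2, ← integral_const_mul, ← Real.norm_eq_abs]
      refine norm_integral_le_of_norm_le (hwint.abs.const_mul ε) ?_
      filter_upwards [ae_restrict_mem hmeas] with p hp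
      rw [norm_mul, mul_comm, Real.norm_eq_abs, Real.norm_eq_abs]
      exact mul_le_mul_of_nonneg_right (hPf p hp) (abs_nonneg _)
    have h0 : Tendsto (fun ε : ℝ => ε * ∫ p in rect a, |w p|) (𝓝[>] 0) (𝓝 0) := by
      have : Continuous fun ε : ℝ => ε * ∫ p in rect a, |w p| := by fun_prop
      simpa using (this.tendsto 0).mono_left nhdsWithin_le_nhds
    have := ge_of_tendsto h0 (by filter_upwards [self_mem_nhdsWithin] with ε hε using hb ε hε)
    exact abs_nonpos_iff.1 this
  have hae := (isOpen_rect a).ae_eq_zero_of_integral_contDiff_smul_eq_zero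
    (f := w) (μ := volume) (IntegrableOn.locallyIntegrableOn hwint) fun g hg _ hgs => by
      rw [← hzero g hg.continuous, setIntegral_mul_eq_of_tsupport_subset (subset_univ _) w hgs
        MeasurableSet.univ, Measure.restrict_univ]
      simp only [smul_eq_mul, mul_comm]
  refine Lp.eq_zero_iff_ae_eq_zero.2 ?_
  filter_upwards [ae_restrict_of_ae hae, ae_restrict_mem hmeas] with p h1 hp
  have hsin : ∀ k, ∀ x ∈ Ioo 0 (a k), 0 < Real.sin (Real.pi / a k * x) := fun k x hx => by
    have hpos : 0 < Real.pi / a k := div_pos Real.pi_pos (ha k)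
    refine Real.sin_pos_of_pos_of_lt_pi (mul_pos hpos hx.1) ?_
    calc Real.pi / a k * x < Real.pi / a k * a k := mul_lt_mul_of_pos_left hx.2 hpos
      _ = Real.pi := div_mul_cancel₀ _ (ha k).ne'
  have h2 : sineProd a 1 1 p ≠ 0 := by
    simp only [sineProd, Int.cast_one, one_mul]
    exact (mul_pos (hsin 0 _ hp.1) (hsin 1 _ hp.2)).ne'
  exact (mul_eq_zero.1 (h1 hp)).resolve_right h2

/-- The Hilbert basis of `L²` of the rectangle formed by the Dirichlet eigenfunctions. -/
def sineBasis (ha : ∀ k, 0 < a k) : HilbertBasis (Fin 2 → ℕ) ℝ (L2 (rect a)) :=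
  HilbertBasis.mkOfOrthogonalEqBot (orthonormal_trigLp ha fun _ => false) <| by
    rw [Submodule.eq_bot_iff]
    intro v hv
    refine eq_zero_of_inner_sine_eq_zero ha fun n => ?_
    exact (Submodule.mem_orthogonal _ _).1 hv _ (Submodule.subset_span ⟨n, rfl⟩)

theorem sineBasis_apply (ha : ∀ k, 0 < a k) (n : Fin 2 → ℕ) :
    sineBasis ha n = trigLp a (fun _ => false) n := by
  rw [sineBasis, HilbertBasis.coe_mkOfOrthogonalEqBot]

end

section


/-! ### The Dirichlet Laplacian on a rectangle -/

theorem inner_sum_partialDeriv_eq {U : Set (ℝ × ℝ)} (w : Fin 2 → L2 U) {φ : ℝ × ℝ → ℝ}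
    (hφ : IsTestFunction U φ) :
    ∫ p in U, ∑ k : Fin 2, (w k : ℝ × ℝ → ℝ) p * partialDeriv k φ p =
      ∑ k, inner ℝ ((hφ.memLp_partialDeriv k).toLp _) (w k) := by
  refine (integral_finsetSum _ fun k _ =>
    (Lp.memLp (w k)).integrable_mul (hφ.memLp_partialDeriv k)).trans ?_
  exact Finset.sum_congr rfl fun k _ => (inner_toLp_eq _ _).symm

/-- A closed relation that holds for the jets of test functions holds on `H₀¹`. -/
theorem mem_of_mem_H10 {U : Set (ℝ × ℝ)} {Z : Set (Jet U)} (hZ : IsClosed Z)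
    (h : ∀ (φ : ℝ × ℝ → ℝ) (hφ : IsTestFunction U φ),
      mkJet (hφ.memLp.toLp φ) (fun k => (hφ.memLp_partialDeriv k).toLp _) ∈ Z)
    {w : Jet U} (hw : w ∈ H10 U) : w ∈ Z := by
  refine closure_minimal ?_ hZ hw
  rintro q ⟨φ, hφ, h1, h2⟩
  have e1 : q.fst = hφ.memLp.toLp φ := Lp.ext (h1.trans hφ.memLp.coeFn_toLp.symm)
  have e2 : q.snd = WithLp.toLp 2 fun k => (hφ.memLp_partialDeriv k).toLp _ :=
    PiLp.ext fun k => Lp.ext ((h2 k).trans (hφ.memLp_partialDeriv k).coeFn_toLp.symm)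
  have e3 : q = mkJet (hφ.memLp.toLp φ) (fun k => (hφ.memLp_partialDeriv k).toLp _) := by
    rw [mkJet, ← e1, ← e2]; rfl
  rw [e3]
  exact h φ hφ

/-- Formal derivatives of a sine series have this shape: bounded multiples of the coefficients of
`g`, carried by another orthonormal family. -/
theorem exists_hasSum_multiplier {ι E E' : Type*} [NormedAddCommGroup E] [InnerProductSpace ℝ E]
    [NormedAddCommGroup E'] [InnerProductSpace ℝ E'] [CompleteSpace E'] (b : HilbertBasis ι ℝ E)
    {φ : ι → E'} (hφ : Orthonormal ℝ φ) {d : ι → ℝ} {K : ℝ} (hd : ∀ n, |d n| ≤ K) (hK : 0 ≤ K)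
    (g : E) : ∃ u, HasSum (fun n => (d n * inner ℝ (b n) g) • φ n) u ∧ ‖u‖ ≤ K * ‖g‖ := by
  obtain ⟨u, hu, hu2⟩ := exists_hasSum_of_orthonormal hφ (summable_mul_inner_sq b hd g)
  refine ⟨u, hu, le_of_sq_le_sq ?_ (by positivity)⟩
  rw [mul_pow]
  refine hasSum_le (fun n => ?_) hu2 ((hilbertBasis_hasSum_sq b g).mul_left (K ^ 2))
  rw [mul_pow]
  exact mul_le_mul_of_nonneg_right (sq_le_sq' (abs_le.1 (hd n)).1 (abs_le.1 (hd n)).2)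
    (sq_nonneg _)

variable {a : Fin 2 → ℝ}

/-- The eigenvalues of the negative Dirichlet Laplacian. -/
def eigenvalue (a : Fin 2 → ℝ) (n : Fin 2 → ℕ) : ℝ := freq a 0 n ^ 2 + freq a 1 n ^ 2

/-! ### Eigenvalue bounds and boundary behaviour of the eigenfunctions. -/

theorem freq_mul_freq_le (k l : Fin 2) (n : Fin 2 → ℕ) :
    |freq a k n * freq a l n| ≤ eigenvalue a n := by
  have h0 := sq_nonneg (freq a 0 n)
  have h1 := sq_nonneg (freq a 1 n)
  have h2 := sq_nonneg (freq a 0 n - freq a 1 n)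
  have h3 := sq_nonneg (freq a 0 n + freq a 1 n)
  rw [abs_le, eigenvalue]
  fin_cases k <;> fin_cases l <;> constructor <;>
    simp only [Fin.mk_zero, Fin.mk_one, Fin.isValue] <;> nlinarith

theorem pi_div_le_freq (ha : ∀ k, 0 < a k) (k : Fin 2) (n : Fin 2 → ℕ) :
    Real.pi / a k ≤ freq a k n := by
  refine div_le_div_of_nonneg_right ?_ (ha k).le
  have : (0 : ℝ) ≤ n k := Nat.cast_nonneg _
  nlinarith [Real.pi_pos]

theorem le_eigenvalue (ha : ∀ k, 0 < a k) (n : Fin 2 → ℕ) :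
    (Real.pi / a 0) ^ 2 ≤ eigenvalue a n := by
  have h1 := pow_le_pow_left₀ (div_pos Real.pi_pos (ha 0)).le (pi_div_le_freq ha 0 n) 2
  rw [eigenvalue]
  linarith [sq_nonneg (freq a 1 n)]

theorem eigenvalue_pos (ha : ∀ k, 0 < a k) (n : Fin 2 → ℕ) : 0 < eigenvalue a n :=
  (pow_pos (div_pos Real.pi_pos (ha 0)) 2).trans_le (le_eigenvalue ha n)

/-- The eigenvalue is at least `freq²`, and `freq ≥ π / a k`; this bounds first derivatives by the
Laplacian. -/
theorem freq_div_eigenvalue_le (ha : ∀ k, 0 < a k) (k : Fin 2) (n : Fin 2 → ℕ) :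
    freq a k n / eigenvalue a n ≤ a k / Real.pi := by
  rw [div_le_div_iff₀ (eigenvalue_pos ha n) Real.pi_pos]
  have h1 := pi_div_le_freq ha k n
  rw [div_le_iff₀ (ha k)] at h1
  have h2 := (le_abs_self _).trans (freq_mul_freq_le (a := a) k k n)
  nlinarith [freq_pos ha k n, ha k]

/-- The zeros lie on countably many lines parallel to the axes. -/
theorem ae_trigProd_ne_zero (ha : ∀ k, 0 < a k) (n : Fin 2 → ℕ) :
    ∀ᵐ p ∂(volume.restrict (rect a)), trigProd a (fun _ => false) n p ≠ 0 := by
  have h1 : ∀ k, ∀ᵐ x : ℝ, Real.sin (freq a k n * x) ≠ 0 := by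
    intro k
    have hc : {x : ℝ | Real.sin (freq a k n * x) = 0}.Countable := by
      refine (countable_range fun m : ℤ => m * Real.pi / freq a k n).mono ?_
      intro x hx
      obtain ⟨m, hm⟩ := Real.sin_eq_zero_iff.1 hx
      exact ⟨m, by
        change (m : ℝ) * Real.pi / freq a k n = x
        rw [hm, mul_div_cancel_left₀ _ (freq_pos ha k n).ne']⟩
    exact hc.ae_notMem volume
  have h2 : ∀ᵐ p : ℝ × ℝ, Real.sin (freq a 0 n * p.1) ≠ 0 :=
    Measure.quasiMeasurePreserving_fst.ae (h1 0)
  have h3 : ∀ᵐ p : ℝ × ℝ, Real.sin (freq a 1 n * p.2) ≠ 0 :=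
    Measure.quasiMeasurePreserving_snd.ae (h1 1)
  filter_upwards [ae_restrict_of_ae h2, ae_restrict_of_ae h3] with p hp hq
  exact mul_ne_zero (div_pos two_pos (Real.sqrt_pos.2 (mul_pos (ha 0) (ha 1)))).ne'
    (mul_ne_zero hp hq)

theorem trigProd_eq_zero_of_mem_frontier (ha : ∀ k, 0 < a k) (n : Fin 2 → ℕ) {p : ℝ × ℝ}
    (hp : p ∈ frontier (rect a)) : trigProd a (fun _ => false) n p = 0 := by
  have hsin : ∀ k, ∀ x ∈ Icc 0 (a k), x ∉ Ioo 0 (a k) → Real.sin (freq a k n * x) = 0 := by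
    intro k x hx hx'
    rcases hx.1.eq_or_lt with rfl | h0
    · simp
    · have : x = a k := le_antisymm hx.2 (not_lt.1 fun h => hx' ⟨h0, h⟩)
      rw [this, freq, div_mul_cancel₀ _ (ha k).ne']
      exact_mod_cast Real.sin_nat_mul_pi (n k + 1)
  have h1 := closure_rect_subset a hp.1
  have h2 : p ∉ rect a := by
    have := hp.2
    rwa [(isOpen_rect a).interior_eq] at this
  simp only [trigProd, trig, cond_false]
  by_cases h : p.1 ∈ Ioo 0 (a 0)
  · rw [hsin 1 _ h1.2 fun h' => h2 ⟨h, h'⟩, mul_zero, mul_zero]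
  · rw [hsin 0 _ h1.1 h, zero_mul, mul_zero]

theorem mkJet_trigLp_mem_H10 (ha : ∀ k, 0 < a k) (n : Fin 2 → ℕ) :
    mkJet (trigLp a (fun _ => false) n)
      (fun k => freq a k n • trigLp a (swapTrig k fun _ => false) n) ∈ H10 (rect a) := by
  refine mkJet_mem_H10 (isOpen_rect a) (isBounded_rect a) (contDiff_trigProd a _ n)
    (fun p hp => trigProd_eq_zero_of_mem_frontier ha n hp) (ae_trigProd_ne_zero ha n)
    (coeFn_trigLp a _ n) fun k => ?_
  have := partialDeriv_trigProd_ae_eq a k (fun _ => false) n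
  simpa only [trigSign, cond_false, one_mul] using this

theorem hasWeakPartialDeriv_trigLp_sine (k : Fin 2) (n : Fin 2 → ℕ) :
    HasWeakPartialDeriv (rect a) k (trigLp a (fun _ => false) n)
      (freq a k n • trigLp a (swapTrig k fun _ => false) n : L2 (rect a)) := by
  have := hasWeakPartialDeriv_trigLp a k (fun _ => false) n
  simpa only [trigSign, cond_false, one_mul] using this

theorem hasWeakPartialDeriv_trigLp_swapTrig_sine (k : Fin 2) (n : Fin 2 → ℕ) :
    HasWeakPartialDeriv (rect a) k (trigLp a (swapTrig k fun _ => false) n)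
      ((-freq a k n) • trigLp a (fun _ => false) n : L2 (rect a)) := by
  have := hasWeakPartialDeriv_trigLp a k (swapTrig k fun _ => false) n
  rw [swapTrig_swapTrig] at this
  simpa [swapTrig, trigSign] using this

/-- `H²` regularity: an element of the domain of the diagonal operator lies in `H₀¹`, has two weak
derivatives bounded by the image, and the trace of its Hessian is the image. -/
theorem exists_weak_hessian (ha : ∀ k, 0 < a k) : ∃ K : ℝ, 0 ≤ K ∧ ∀ v g : L2 (rect a),
    IsDiagonalImage (sineBasis ha) (eigenvalue a) v g →
    ∃ (w : Fin 2 → L2 (rect a)) (q : Fin 2 → Fin 2 → L2 (rect a)),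
      (∀ k, HasWeakPartialDeriv (rect a) k v (w k)) ∧
      (∀ k l, HasWeakPartialDeriv (rect a) l (w k) (q k l)) ∧
      (∀ k, ‖w k‖ ≤ K * ‖g‖) ∧ (∀ k l, ‖q k l‖ ≤ K * ‖g‖) ∧
      mkJet v w ∈ H10 (rect a) ∧ q 0 0 + q 1 1 = g := by
  set K : ℝ := 1 + a 0 / Real.pi + a 1 / Real.pi with hK
  have hk0 : ∀ k, 0 < a k / Real.pi := fun k => div_pos (ha k) Real.pi_pos
  have hKk : ∀ k, a k / Real.pi ≤ K := by
    rw [Fin.forall_fin_two]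
    constructor <;> linarith [hk0 0, hk0 1]
  have hK1 : 1 ≤ K := by linarith [hk0 0, hk0 1]
  have hK0 : 0 ≤ K := by linarith
  refine ⟨K, hK0, fun v g hvg => ?_⟩
  -- The multipliers act on the coefficients of `g`, since those of `v` are `-1/λ` times them;
  -- dividing by `λ` is what makes first and second derivatives bounded in `g`.
  set d : Fin 2 → (Fin 2 → ℕ) → ℝ := fun k n => -(freq a k n / eigenvalue a n) with hd
  set d₂ : Fin 2 → Fin 2 → (Fin 2 → ℕ) → ℝ := fun k l n =>
    trigSign (swapTrig k (fun _ => false) l) * freq a l n * d k n with hd₂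
  have hdK : ∀ k n, |d k n| ≤ K := by
    intro k n
    rw [hd, abs_neg, abs_of_pos (div_pos (freq_pos ha k n) (eigenvalue_pos ha n))]
    exact (freq_div_eigenvalue_le ha k n).trans (hKk k)
  have hd₂K : ∀ k l n, |d₂ k l n| ≤ K := by
    intro k l n
    have h1 : d₂ k l n = -trigSign (swapTrig k (fun _ => false) l) *
        ((freq a l n * freq a k n) / eigenvalue a n) := by
      simp only [hd₂, hd]; ring
    rw [h1, abs_mul, abs_neg, abs_trigSign, one_mul, abs_div, abs_of_pos (eigenvalue_pos ha n)]
    exact ((div_le_one (eigenvalue_pos ha n)).2 (freq_mul_freq_le l k n)).trans hK1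
  have hwex := fun k => exists_hasSum_multiplier (sineBasis ha)
    (orthonormal_trigLp ha (swapTrig k fun _ => false)) (hdK k) hK0 g
  choose w hw hwK using hwex
  have hqex := fun k l => exists_hasSum_multiplier (sineBasis ha)
    (orthonormal_trigLp ha (swapTrig l (swapTrig k fun _ => false))) (hd₂K k l) hK0 g
  choose q hq hqK using hqex
  have hexp : ∀ u : L2 (rect a), HasSum (fun n => inner ℝ (sineBasis ha n) u •
      trigLp a (fun _ => false) n) u := by
    intro u
    have := (sineBasis ha).hasSum_repr u
    simp only [HilbertBasis.repr_apply_apply] at this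
    simpa only [sineBasis_apply] using this
  have hdv : ∀ k n, d k n * inner ℝ (sineBasis ha n) g =
      inner ℝ (sineBasis ha n) v * freq a k n := by
    intro k n
    have := (eigenvalue_pos ha n).ne'
    rw [hvg n, hd]; field_simp
  refine ⟨w, q, fun k => ?_, fun k l => ?_, hwK, hqK, ?_, ?_⟩
  · refine HasWeakPartialDeriv.of_hasSum (fun n => ?_) (hexp v) (hw k)
    rw [hdv, ← smul_smul]
    exact (hasWeakPartialDeriv_trigLp_sine k n).smul _
  · refine HasWeakPartialDeriv.of_hasSum (fun n => ?_) (hw k) (hq k l)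
    have := (hasWeakPartialDeriv_trigLp a l (swapTrig k fun _ => false) n).smul
      (d k n * inner ℝ (sineBasis ha n) g)
    rw [smul_smul] at this
    convert this using 2
    simp only [hd₂]
    ring_nf
  · refine mkJet_mem_H10_of_hasSum (u := fun n => inner ℝ (sineBasis ha n) v •
      trigLp a (fun _ => false) n) (g := fun n k => inner ℝ (sineBasis ha n) v •
      freq a k n • trigLp a (swapTrig k fun _ => false) n) (fun n => ?_) (hexp v) fun k => ?_
    · have := mkJet_trigLp_mem_H10 ha n
      rw [H10_eq, SetLike.mem_coe] at this ⊢
      exact (testJets (rect a)).topologicalClosure.smul_mem (inner ℝ (sineBasis ha n) v) this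
    · simpa only [hdv, ← smul_smul] using hw k
  · have h1 := (hq 0 0).add (hq 1 1)
    refine h1.unique ((hexp g).congr_fun fun n => ?_)
    rw [swapTrig_swapTrig, swapTrig_swapTrig, ← add_smul, ← add_mul]
    -- The pure second derivatives carry the multipliers `freq² / λ`, whose sum over the two
    -- directions is `1`.
    have h2 : d₂ 0 0 n + d₂ 1 1 n = 1 := by
      have h3 := (eigenvalue_pos ha n).ne'
      simp only [hd₂, hd, swapTrig, Function.update_self, trigSign, Bool.not_false, cond_true]
      field_simp
      rw [eigenvalue]
    rw [h2, one_mul]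

/-- The Dirichlet Laplacian of a rectangle is diagonal in the sine basis. -/
theorem dirichletLaplacian_iff (ha : ∀ k, 0 < a k) (v g : L2 (rect a)) :
    DirichletLaplacian (rect a) v g ↔ IsDiagonalImage (sineBasis ha) (eigenvalue a) v g := by
  constructor
  · rintro ⟨w, hw, rfl, hweak⟩ n
    set J : Fin 2 → L2 (rect a) :=
      fun k => freq a k n • trigLp a (swapTrig k fun _ => false) n with hJ
    set e : L2 (rect a) := trigLp a (fun _ => false) n with he
    -- The weak equation extends by density from test functions to the eigenfunction, which lies in
    -- `H₀¹`.
    have h1 : mkJet e J ∈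
        {q : Jet (rect a) | ∑ k, inner ℝ (q.snd k) (w.snd k) = -inner ℝ q.fst g} := by
      refine mem_of_mem_H10 (isClosed_eq (by fun_prop) (by fun_prop)) (fun φ hφ => ?_)
        (mkJet_trigLp_mem_H10 ha n)
      have := hweak φ hφ
      rw [inner_sum_partialDeriv_eq _ hφ, ← inner_toLp_eq _ hφ.memLp] at this
      exact this
    -- Here the roles are exchanged: the eigenfunction equation is tested against `w`, approximated
    -- by test functions. Comparing both gives the `n`-th coordinate of `g`.
    have h2 : w ∈ {q : Jet (rect a) | ∑ k, inner ℝ (q.snd k) (J k) =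
        eigenvalue a n * inner ℝ q.fst e} := by
      refine mem_of_mem_H10 (isClosed_eq (by fun_prop) (by fun_prop)) (fun φ hφ => ?_) hw
      have h3 : ∀ k, inner ℝ ((hφ.memLp_partialDeriv k).toLp _) (J k) =
          freq a k n ^ 2 * inner ℝ (hφ.memLp.toLp φ) e := by
        intro k
        have := hasWeakPartialDeriv_L2_iff.1 (hasWeakPartialDeriv_trigLp_swapTrig_sine k n) φ hφ
        rw [hJ, inner_smul_right, this, inner_smul_right]
        ring
      change ∑ k, inner ℝ ((hφ.memLp_partialDeriv k).toLp _) (J k) =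
        eigenvalue a n * inner ℝ (hφ.memLp.toLp φ) e
      rw [Fin.sum_univ_two, h3, h3, eigenvalue, add_mul]
    have h3 : ∑ k, inner ℝ (J k) (w.snd k) = -inner ℝ e g := h1
    have h4 : ∑ k, inner ℝ (w.snd k) (J k) = eigenvalue a n * inner ℝ w.fst e := h2
    simp only [fun k => real_inner_comm (J k) (w.snd k)] at h4
    rw [sineBasis_apply, ← he, real_inner_comm w.fst e]
    linarith
  · intro h
    obtain ⟨K, -, hK⟩ := exists_weak_hessian ha
    obtain ⟨w, q, -, hq, -, -, hmem, hsum⟩ := hK v g h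
    refine ⟨mkJet v w, hmem, rfl, fun φ hφ => ?_⟩
    have h1 := inner_sum_partialDeriv_eq w hφ
    refine h1.trans ?_
    rw [← inner_toLp_eq g hφ.memLp, ← hsum, inner_add_right, Fin.sum_univ_two,
      hasWeakPartialDeriv_L2_iff.1 (hq 0 0) φ hφ, hasWeakPartialDeriv_L2_iff.1 (hq 1 1) φ hφ]
    ring

/-- Restriction of square integrable functions to a smaller set. -/
def restrictL2 {U V : Set (ℝ × ℝ)} (hUV : U ⊆ V) (u : L2 V) : L2 U :=
  ((Lp.memLp u).mono_measure (Measure.restrict_mono hUV le_rfl)).toLp u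

theorem coeFn_restrictL2 {U V : Set (ℝ × ℝ)} (hUV : U ⊆ V) (u : L2 V) :
    restrictL2 hUV u =ᵐ[volume.restrict U] u :=
  MemLp.coeFn_toLp _

theorem norm_restrictL2_le {U V : Set (ℝ × ℝ)} (hUV : U ⊆ V) (u : L2 V) :
    ‖restrictL2 hUV u‖ ≤ ‖u‖ := by
  rw [restrictL2, Lp.norm_toLp, Lp.norm_def]
  exact ENNReal.toReal_mono (Lp.eLpNorm_ne_top u)
    (eLpNorm_mono_measure _ (Measure.restrict_mono hUV le_rfl))

/-- Elements of the domain of the Dirichlet Laplacian have a regional gradient, bounded by the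
Laplacian. -/
theorem exists_isRegionalGradient (ha : ∀ k, 0 < a k) {ω : Set (ℝ × ℝ)} (hω : ω ⊆ rect a) :
    ∃ K : ℝ, 0 < K ∧ ∀ v g : L2 (rect a), DirichletLaplacian (rect a) v g →
      ∃ P : H1Sq ω, IsRegionalGradient ω v P ∧ ‖P‖ ≤ K * ‖g‖ := by
  obtain ⟨K, hK0, hK⟩ := exists_weak_hessian ha
  -- Six components, each of norm at most `K‖g‖`, give `√6 K ≤ 3K`; the extra `1` ensures positivity
  -- when `K = 0`.
  refine ⟨3 * K + 1, by linarith, fun v g hvg => ?_⟩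
  obtain ⟨w, q, hw, hq, hwK, hqK, -, -⟩ := hK v g ((dirichletLaplacian_iff ha v g).1 hvg)
  have hmeas := (isOpen_rect a).measurableSet
  refine ⟨WithLp.toLp 2 fun k => ⟨mkJet (restrictL2 hω (w k)) fun l => restrictL2 hω (q k l),
    fun l => ((hq k l).mono hmeas hω).congr (coeFn_restrictL2 hω _).symm
      (coeFn_restrictL2 hω _).symm⟩,
    fun k => ((hw k).mono hmeas hω).congr (ae_eq_refl _) (coeFn_restrictL2 hω _).symm, ?_⟩
  have hb : ∀ u : L2 (rect a), ‖u‖ ≤ K * ‖g‖ → ‖restrictL2 hω u‖ ^ 2 ≤ (K * ‖g‖) ^ 2 :=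
    fun u hu => pow_le_pow_left₀ (norm_nonneg _) ((norm_restrictL2_le hω u).trans hu) 2
  have hKg : 0 ≤ K * ‖g‖ := mul_nonneg hK0 (norm_nonneg _)
  refine le_trans (le_of_sq_le_sq (b := 3 * (K * ‖g‖)) ?_ (by positivity))
    (by nlinarith [norm_nonneg g])
  have hjet : ∀ (u : L2 ω) (g : Fin 2 → L2 ω), ‖mkJet u g‖ ^ 2 =
      ‖u‖ ^ 2 + (‖g 0‖ ^ 2 + ‖g 1‖ ^ 2) := by
    intro u g
    rw [WithLp.prod_norm_sq_eq_of_L2, PiLp.norm_sq_eq_of_L2, Fin.sum_univ_two]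
    rfl
  rw [PiLp.norm_sq_eq_of_L2, Fin.sum_univ_two]
  simp only [Submodule.coe_norm, hjet]
  nlinarith [hb _ (hwK 0), hb _ (hwK 1), hb _ (hqK 0 0), hb _ (hqK 0 1), hb _ (hqK 1 0),
    hb _ (hqK 1 1), sq_nonneg (K * ‖g‖)]

end

/-! ### The observer -/

/-- The output of the zone sensor as a bounded functional. -/
theorem exists_clm_eq_zoneOutput {Ω D : Set (ℝ × ℝ)} (hD : MeasurableSet D) (hDΩ : D ⊆ Ω)
    {f : ℝ × ℝ → ℝ} (hf : MemLp f 2 (volume.restrict D)) :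
    ∃ c : L2 Ω →L[ℝ] ℝ, ∀ v, c v = zoneOutput D f v := by
  have h1 : MemLp (D.indicator f) 2 (volume.restrict Ω) := by
    rw [memLp_indicator_iff_restrict hD, Measure.restrict_restrict_of_subset hDΩ]
    exact hf
  refine ⟨innerSL ℝ (h1.toLp _), fun v => ?_⟩
  rw [innerSL_apply_apply, inner_toLp_eq, zoneOutput]
  have h2 : (fun p => v p * D.indicator f p) = D.indicator fun p => v p * f p := by
    ext p
    by_cases hp : p ∈ D <;> simp [hp]
  rw [h2, integral_indicator hD, Measure.restrict_restrict_of_subset hDΩ]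

section Rectangle

variable {a : Fin 2 → ℝ}

/-- The heat semigroup of the rectangle with Dirichlet boundary conditions. -/
def heatSemigroup (ha : ∀ k, 0 < a k) : ℝ → L2 (rect a) →L[ℝ] L2 (rect a) :=
  diagonalSemigroup (sineBasis ha) fun n => (eigenvalue_pos ha n).le

theorem dirichletLaplacian_eq (ha : ∀ k, 0 < a k) :
    DirichletLaplacian (rect a) = IsDiagonalImage (sineBasis ha) (eigenvalue a) := by
  ext v g
  exact dirichletLaplacian_iff ha v g

theorem generates_heatSemigroup (ha : ∀ k, 0 < a k) :
    Generates (DirichletLaplacian (rect a)) (heatSemigroup ha) := by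
  rw [dirichletLaplacian_eq ha]
  exact generates_diagonalSemigroup _ _

/-- The gradient of `S(t)v` is bounded by `‖A S(t)v‖ = ‖S(t)Av‖`, which decays at the spectral gap.
-/
theorem isRegionallyGradientStable_heatSemigroup (ha : ∀ k, 0 < a k) {ω : Set (ℝ × ℝ)}
    (hω : ω ⊆ rect a) :
    IsRegionallyGradientStable ω (DirichletLaplacian (rect a)) (heatSemigroup ha) := by
  obtain ⟨K, hK0, hK⟩ := exists_isRegionalGradient ha hω
  refine ⟨K, (Real.pi / a 0) ^ 2, hK0, pow_pos (div_pos Real.pi_pos (ha 0)) 2,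
    fun v g hvg t ht => ?_⟩
  obtain ⟨P, hP, hPn⟩ := hK _ _ ((generates_heatSemigroup ha).map_apply hvg ht)
  refine ⟨P, hP, hPn.trans ?_⟩
  rw [mul_assoc]
  refine mul_le_mul_of_nonneg_left ?_ hK0.le
  refine (norm_diagonalSemigroup_apply_le (sineBasis ha) _ (le_eigenvalue ha) ht g).trans ?_
  exact mul_le_mul_of_nonneg_left (by linarith [norm_nonneg v]) (Real.exp_pos _).le

theorem outputInjection_zero {E : Type*} [AddCommGroup E] [Module ℝ E] (A : E → E → Prop)
    (C : E → ℝ) : outputInjection A C 0 = A := by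
  ext v g
  simp [outputInjection]

theorem isStabilizingGain_zero (ha : ∀ k, 0 < a k) {ω : Set (ℝ × ℝ)} (hω : ω ⊆ rect a)
    (C : L2 (rect a) → ℝ) : IsStabilizingGain ω (DirichletLaplacian (rect a)) C 0 := by
  rw [IsStabilizingGain, outputInjection_zero]
  exact ⟨heatSemigroup ha, generates_heatSemigroup ha,
    isRegionallyGradientStable_heatSemigroup ha hω⟩

variable {c : L2 (rect a) →L[ℝ] ℝ} {h : L2 (rect a)} {S : ℝ → L2 (rect a) →L[ℝ] L2 (rect a)}

theorem outputInjection_of_dirichletLaplacian {v g : L2 (rect a)}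
    (hv : DirichletLaplacian (rect a) v g) :
    outputInjection (DirichletLaplacian (rect a)) c h v (g - c v • h) := by
  rw [outputInjection, sub_add_cancel]
  exact hv

/-- The semigroup generated by `A - H C` maps into the domain of the generator at positive
times. -/
theorem exists_outputInjection_apply (ha : ∀ k, 0 < a k)
    (hS : Generates (outputInjection (DirichletLaplacian (rect a)) c h) S)
    (v : L2 (rect a)) {t : ℝ} (ht : 0 < t) :
    ∃ g, outputInjection (DirichletLaplacian (rect a)) c h (S t v) g := by
  have hdense : Dense {v | ∃ g, outputInjection (DirichletLaplacian (rect a)) c h v g} := by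
    refine (dense_domain_isDiagonalImage (sineBasis ha) fun n =>
      (eigenvalue_pos ha n).le).mono ?_
    rintro w ⟨g, hg⟩
    exact ⟨_, outputInjection_of_dirichletLaplacian ((dirichletLaplacian_iff ha w g).2 hg)⟩
  -- Duhamel is used in reverse, with the heat generator as the perturbation of `A - HC` by the
  -- functional `-c`.
  have h1 := hS.apply_eq_add_integral (generates_heatSemigroup ha) hdense (-c) h
    (fun w g hw => by
      rw [neg_apply, neg_smul, sub_neg_eq_add]
      exact hw) v ht.le
  have hcont : Continuous fun s : ℝ => (-c) (S (max s 0) v) :=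
    (-c).continuous.comp (hS.1.continuous_uncurry.comp (continuous_id.prodMk continuous_const))
  obtain ⟨g₁, hg₁⟩ := exists_isDiagonalImage_diagonalSemigroup (sineBasis ha)
    (fun n => (eigenvalue_pos ha n).le) ht v
  obtain ⟨g₂, hg₂⟩ := exists_isDiagonalImage_integral (sineBasis ha)
    (fun n => (eigenvalue_pos ha n).le) hcont h ht.le
  refine ⟨_, outputInjection_of_dirichletLaplacian (g := g₁ + g₂)
    ((dirichletLaplacian_iff ha _ _).2 fun n => ?_)⟩
  rw [h1, inner_add_right, inner_add_right, hg₁ n, hg₂ n, mul_add]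
  rfl

/-- The estimation error has a regional gradient that decays to zero. -/
theorem exists_tendsto_regionalGradient (ha : ∀ k, 0 < a k) {ω : Set (ℝ × ℝ)}
    (hS : Generates (outputInjection (DirichletLaplacian (rect a)) c h) S)
    (hstab : IsRegionallyGradientStable ω (outputInjection (DirichletLaplacian (rect a)) c h) S)
    (v : L2 (rect a)) :
    ∃ e : ℝ → H1Sq ω, (∀ t : ℝ, 0 < t → IsRegionalGradient ω (S t v) (e t)) ∧
      Tendsto e atTop (𝓝 0) := by
  obtain ⟨M, α, hM, hα, hP⟩ := hstab
  -- The orbit is restarted at time `1`, where it has entered the domain. Before that only existence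
  -- of the gradient is needed, from stability at elapsed time `0`.
  obtain ⟨g₁, hg₁⟩ := exists_outputInjection_apply ha hS v one_pos
  have key : ∀ t : ℝ, ∃ P : H1Sq ω, (0 < t → IsRegionalGradient ω (S t v) P) ∧
      (1 ≤ t → ‖P‖ ≤ M * Real.exp (-(α * (t - 1))) * (‖S 1 v‖ + ‖g₁‖)) := by
    intro t
    rcases le_or_gt 1 t with h1 | h1
    · obtain ⟨P, hP1, hP2⟩ := hP _ _ hg₁ (t - 1) (sub_nonneg.2 h1)
      rw [← ContinuousLinearMap.comp_apply, ← hS.1.2.1 _ _ (sub_nonneg.2 h1) zero_le_one,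
        sub_add_cancel] at hP1
      exact ⟨P, fun _ => hP1, fun _ => hP2⟩
    · by_cases h0 : 0 < t
      · obtain ⟨g, hg⟩ := exists_outputInjection_apply ha hS v h0
        obtain ⟨P, hP1, -⟩ := hP _ _ hg 0 le_rfl
        rw [hS.1.1, ContinuousLinearMap.id_apply] at hP1
        exact ⟨P, fun _ => hP1, fun h => absurd h1 (not_lt.2 h)⟩
      · exact ⟨0, fun h => absurd h h0, fun h => absurd h1 (not_lt.2 h)⟩
  choose e he1 he2 using key
  refine ⟨e, he1, squeeze_zero_norm' (eventually_atTop.2 ⟨1, he2⟩) ?_⟩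
  have h1 : Tendsto (fun t : ℝ => α * (t - 1)) atTop atTop :=
    (tendsto_atTop_add_const_right atTop (-1) tendsto_id).const_mul_atTop hα
  have h2 := ((Real.tendsto_exp_neg_atTop_nhds_zero.comp h1).const_mul M).mul_const
    (‖S 1 v‖ + ‖g₁‖)
  simpa using h2

/-- The control and the measured output cancel in the error, which is therefore a free orbit of the
semigroup of `A - HC`. -/
theorem isGAObserver_of_isStabilizingGain (ha : ∀ k, 0 < a k) {ω : Set (ℝ × ℝ)}
    (hω : ω ⊆ rect a) {V : Type*} [NormedAddCommGroup V] [NormedSpace ℝ V]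
    (B : V →L[ℝ] L2 (rect a)) (c : L2 (rect a) →L[ℝ] ℝ) {h : L2 (rect a)}
    (hh : IsStabilizingGain ω (DirichletLaplacian (rect a)) c h) :
    IsGAObserver ω (DirichletLaplacian (rect a)) B c
      (outputInjection (DirichletLaplacian (rect a)) c h) B h
      (ContinuousLinearMap.id ℝ (L2 (rect a))) := by
  obtain ⟨S, hS, hstab⟩ := hh
  refine ⟨fun v g hv => outputInjection_of_dirichletLaplacian hv,
    (ContinuousLinearMap.id_comp B).symm, ⟨0, ContinuousLinearMap.id ℝ _, fun v g hv => ?_⟩,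
    heatSemigroup ha, S, generates_heatSemigroup ha, hS, hstab, ?_⟩
  · obtain ⟨K, -, hK⟩ := exists_isRegionalGradient ha hω
    obtain ⟨P, hP, -⟩ := hK v g hv
    exact ⟨P, P, hP, hP, by simp⟩
  · intro x₀ z₀ u hu x z hx hz
    have hdense : Dense {v | ∃ g, DirichletLaplacian (rect a) v g} := by
      rw [dirichletLaplacian_eq ha]
      exact dense_domain_isDiagonalImage _ fun n => (eigenvalue_pos ha n).le
    obtain ⟨e, he, hlim⟩ := exists_tendsto_regionalGradient ha hS hstab (z₀ - x₀)
    refine ⟨e, fun t ht => ?_, hlim⟩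
    -- On a bounded interval square integrability of the control gives integrability.
    have hB : IntegrableOn (fun τ => B (u τ)) (Ioc 0 t) :=
      B.integrable_comp ((hu t ht).integrable one_le_two)
    have h1 := mildSolution_eq_of_perturbation (generates_heatSemigroup ha).1 hS.1 c h
      (fun v s hs => (generates_heatSemigroup ha).apply_eq_add_integral hS hdense c h
        (fun _ _ hw => outputInjection_of_dirichletLaplacian hw) v hs) ht.le hB hx z₀
    rw [ContinuousLinearMap.id_apply, hz t ht.le, h1]
    exact he t ht

end Rectangle

end GradientObserver

end

open GradientObserver in
theorem corollary5p1
    (a₁ a₂ : ℝ) (ha₁ : 0 < a₁) (ha₂ : 0 < a₂)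
    (Ω : Set (ℝ × ℝ)) (hΩ : Ω = Ioo 0 a₁ ×ˢ Ioo 0 a₂)
    (ω : Set (ℝ × ℝ)) (hω : IsOpen ω) (hωne : ω.Nonempty) (hωΩ : ω ⊆ Ω)
    (ξ₀₁ ξ₀₂ l₁ l₂ : ℝ) (hl₁ : 0 < l₁) (hl₂ : 0 < l₂)
    (D : Set (ℝ × ℝ))
    (hD : D = Ioo (ξ₀₁ - l₁) (ξ₀₁ + l₁) ×ˢ Ioo (ξ₀₂ - l₂) (ξ₀₂ + l₂)) (hDΩ : D ⊆ Ω)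
    (f : ℝ × ℝ → ℝ) (hf : MemLp f 2 (volume.restrict D))
    (hsymm₁ : ∀ᵐ p ∂(volume.restrict D), f (2 * ξ₀₁ - p.1, p.2) = f p)
    (hsymm₂ : ∀ᵐ p ∂(volume.restrict D), f (p.1, 2 * ξ₀₂ - p.2) = f p)
    (J : ℕ)
    (hJ₁ : ∀ i : ℕ, 1 ≤ i → i ≤ J → ∀ n : ℕ, (i : ℝ) * ξ₀₁ / a₁ ≠ n)
    (hJ₂ : ∀ j : ℕ, 1 ≤ j → j ≤ J → ∀ n : ℕ, (j : ℝ) * ξ₀₂ / a₂ ≠ n)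
    (m : ℕ) (B : EuclideanSpace ℝ (Fin m) →L[ℝ] L2 Ω) :
    (∃ h : L2 Ω, IsStabilizingGain ω (DirichletLaplacian Ω) (zoneOutput D f) h) ∧
    ∀ h : L2 Ω, IsStabilizingGain ω (DirichletLaplacian Ω) (zoneOutput D f) h →
      IsGAObserver ω (DirichletLaplacian Ω) B (zoneOutput D f)
        (outputInjection (DirichletLaplacian Ω) (zoneOutput D f) h) B h
        (ContinuousLinearMap.id ℝ (L2 Ω)) := by
  set a : Fin 2 → ℝ := ![a₁, a₂] with ha_def
  have ha : ∀ k, 0 < a k := Fin.forall_fin_two.2 ⟨ha₁, ha₂⟩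
  obtain rfl : Ω = rect a := hΩ
  have hDmeas : MeasurableSet D := by
    rw [hD]
    exact measurableSet_Ioo.prod measurableSet_Ioo
  obtain ⟨c, hc⟩ := exists_clm_eq_zoneOutput hDmeas hDΩ hf
  have hc' : zoneOutput D f = c := funext fun v => (hc v).symm
  rw [hc']
  -- The zero gain is the witness, the heat semigroup being stable by itself.
  exact ⟨⟨0, isStabilizingGain_zero ha hωΩ c⟩,
    fun h hh => isGAObserver_of_isStabilizingGain ha hωΩ B c hh⟩
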